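/- Let $d\ge 0$ and let $\mathbb C\langle x_1,\dots,x_d\rangle$ be the $*$-algebra of polynomials in non-commuting self-adjoint variables; for a word $\vec u=(u(1),\dots,u(n))$ write $x_{\vec u}=x_{u(1)}\cdots x_{u(n)}$, and $X_{\vec u}=X_{u(1)}\cdots X_{u(n)}$ for operators $X_1,\dots,X_d$. A state is a linear functional $\phi$ on it that is unital, $*$-compatible and satisfies $\phi[P^*P]\ge 0$. For a unital functional $\phi$ let $M^\phi(\mathbf w)=\sum_{|\vec u|\ge 1}\phi[x_{\vec u}]w_{\vec u}$ be its moment series in non-commuting variables, $\eta^\phi=1-(1+M^\phi)^{-1}$ its Boolean cumulant series, and $R^\phi$ its free cumulant series, i.e. the series without constant term determined by $M^\phi(\mathbf w)=R^\phi\bigl((1+M^\phi(\mathbf w))\mathbf w\bigr)$. Unital functionals $\phi\boxplus\psi$, $\phi^{\boxplus t}$, $\Phi[\rho,\psi]$, $\mathbb B[\phi]$ are defined by $$R^{\phi\boxplus\psi}=R^\phi+R^\psi,\qquad R^{\phi^{\boxplus t}}=tR^\phi,\qquad \eta^{\Phi[\rho,\psi]}(\mathbf w)=(1+M^\psi(\mathbf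 w))^{-1}R^\rho\bigl((1+M^\psi(\mathbf w))\mathbf w\bigr),\qquad R^{\mathbb B[\phi]}=\eta^\phi .$$ A state $\rho$ is freely infinitely divisible if $\rho^{\boxplus t}$ is a state for all $t\ge 0$. The Boolean Fock space of a Hilbert space $\mathcal H$ is $\mathbb C\Omega\oplus\mathcal H$, with $a^{b,+}_\zeta(\varepsilon)=\langle\Omega,\varepsilon\rangle\zeta$, $a^{b,-}_\zeta(\varepsilon)=\langle\zeta,\varepsilon\rangle\Omega$, and operators on $\mathcal H$ extended by $\Omega\mapsto 0$. The full Fock space is $\mathcal F(\mathcal H)=\mathbb C\Omega\oplus\bigoplus_{n\ge1}\mathcal H^{\otimes n}$, with $a^{f,+}_\zeta(\varepsilon_1\otimes\dots\otimes\varepsilon_n)=\zeta\otimes\varepsilon_1\otimes\dots\otimes\varepsilon_n$, $a^{f,-}_\zeta(\varepsilon_1\otimes\dots\otimes\varepsilon_n)=\langle\zeta,\varepsilon_1\rangle\varepsilon_2\otimes\dots\otimes\varepsilon_n$, $p(H)(\varepsilon_1\otimes\dots\otimes\varepsilon_n)=(H\varepsilon_1)\otimes\varepsilon_2\otimes\dots\otimes\varepsilon_n$,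 and $a^{f,-}_\zeta\Omega=p(H)\Omega=0$. $P_\Omega$, $P_\xi$ denote the projections onto $\Omega$, $\xi$. All tuples of operators below are symmetric operators with a common invariant dense domain containing the distinguished vectors; domains of operators on tensor products and Fock spaces are the algebraic ones built from the given domains. Consider the following data: for a state $\psi$, a Hilbert space $\mathcal K$, a unit vector $\xi\in\mathcal K$ and operators $K_i$ on $\mathcal K$ with $\psi[x_{\vec u}]=\langle\xi,K_{\vec u}\xi\rangle$; for a state $\phi$, a Hilbert space $\mathcal K$, $\varepsilon_i\in\mathcal K$, operators $S_i$ on $\mathcal K$ and $\alpha_i\in\mathbb R$ with $\phi[x_{\vec u}]=\langle\Omega,(a^{b,+}_{\varepsilon_i}+a^{b,-}_{\varepsilon_i}+S_i+\alpha_iP_\Omega)_{\vec u}\Omega\rangle$; for a freely infinitely divisible state $\rho$, a Hilbert space $\mathcal H$, $\zeta_i\in\mathcal H$, operators $H_i$ on $\mathcal H$ and $\lambda_i\in\mathbb R$ with $\rho[x_{\vec u}]=\langle\Omega,(a^{f,+}_{\zeta_i}+a^{f,-}_{\zeta_i}+p(H_i)+\lambda_iI)_{\vec u}\Omega\rangle$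 on $\mathcal F(\mathcal H)$. Such data exist for all such $\psi$, $\phi$, $\rho$, and for any choice of them the following hold. (a) For a freely infinitely divisible state $\rho$ and a state $\psi$, $\Phi[\rho,\psi]$ is a state, represented on the Boolean Fock space $\mathbb C\Omega\oplus(\mathcal K\otimes\mathcal H)$ by $$\Phi[\rho,\psi][x_{\vec u}]=\Bigl\langle\Omega,\bigl(a^{b,+}_{\xi\otimes\zeta_i}+a^{b,-}_{\xi\otimes\zeta_i}+K_i\otimes I+P_\xi\otimes H_i+\lambda_iP_\Omega\bigr)_{\vec u}\Omega\Bigr\rangle .$$ (b) For a state $\phi$, $\mathbb B[\phi]$ is a freely infinitely divisible state, represented on $\mathcal F(\mathcal K)$ by $$\mathbb B[\phi][x_{\vec u}]=\Bigl\langle\Omega,\bigl(a^{f,+}_{\varepsilon_i}+a^{f,-}_{\varepsilon_i}+p(S_i)+\alpha_iI\bigr)_{\vec u}\Omega\Bigr\rangle .$$ (c) For $\rho,\psi$ as in (a), $\psi\boxplus\rho$ is a state, represented on $\mathcal F(\mathcal K\otimes\mathcal H)\otimes\mathcal K\simeq\mathcal K\oplus\bigoplus_{n\ge1}(\mathcal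 K\otimes\mathcal H)^{\otimes n}\otimes\mathcal K$ by $$(\psi\boxplus\rho)[x_{\vec u}]=\Bigl\langle\Omega\otimes\xi,\bigl(a^{f,+}_{\xi\otimes\zeta_i}\otimes I+a^{f,-}_{\xi\otimes\zeta_i}\otimes I+P_\Omega\otimes K_i+p(K_i\otimes I)\otimes I+p(P_\xi\otimes H_i)\otimes I+\lambda_iI\bigr)_{\vec u}(\Omega\otimes\xi)\Bigr\rangle ,$$ where $P_\Omega\otimes K_i+p(K_i\otimes I)\otimes I$ is the action of $K_i$ on the leftmost factor $\mathcal K$ of every summand. (d) For $\rho,\psi$ as in (a), $\mathbb B[\Phi[\rho,\psi]]=\Phi[\rho,\psi\boxplus\rho]$, and both are represented on $\mathcal F(\mathcal K\otimes\mathcal H)$ by $$\Bigl\langle\Omega,\bigl(a^{f,+}_{\xi\otimes\zeta_i}+a^{f,-}_{\xi\otimes\zeta_i}+p(K_i\otimes I+P_\xi\otimes H_i)+\lambda_iI\bigr)_{\vec u}\Omega\Bigr\rangle .$$ -/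

import Mathlib

open scoped InnerProductSpace TensorProduct DirectSum ComplexConjugate

universe u v

noncomputable section

namespace TwoState

/-! ### Non-commutative polynomials, functionals and states -/

/-- The algebra `ℂ⟨x₁, …, x_d⟩` of polynomials in `d` non-commuting variables. -/
abbrev NCPoly (d : ℕ) : Type := MonoidAlgebra ℂ (FreeMonoid (Fin d))

/-- The monomial `x_{u(1)} x_{u(2)} ⋯ x_{u(n)}`. -/
def monomial {d : ℕ} (u : List (Fin d)) : NCPoly d :=
  MonoidAlgebra.single (FreeMonoid.ofList u) 1

/-- The involution of `ℂ⟨x₁, …, x_d⟩`: conjugate-linear, reversing words, fixing each `x_i`. -/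
def adj {d : ℕ} (P : NCPoly d) : NCPoly d :=
  P.coeff.sum fun u c => MonoidAlgebra.single (FreeMonoid.ofList u.toList.reverse) (conj c)

/-- Linear functionals on `ℂ⟨x₁, …, x_d⟩`. -/
abbrev Functional (d : ℕ) : Type := NCPoly d →ₗ[ℂ] ℂ

/-- States: unital, `*`-compatible and positive linear functionals. -/
structure IsState {d : ℕ} (φ : Functional d) : Prop where
  map_one : φ 1 = 1
  map_adj : ∀ P, φ (adj P) = conj (φ P)
  nonneg : ∀ P, 0 ≤ (φ (adj P * P)).re

/-! ### Non-commutative formal power series -/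

/-- Formal power series in `d` non-commuting variables, given by their coefficients. -/
abbrev NCSeries (d : ℕ) : Type := List (Fin d) → ℂ

namespace NCSeries

variable {d : ℕ}

/-- The series `1`. -/
def one : NCSeries d := fun u => if u = [] then 1 else 0

/-- The product of two series. -/
def mul (f g : NCSeries d) : NCSeries d := fun u =>
  ∑ k ∈ Finset.range (u.length + 1), f (u.take k) * g (u.drop k)

/-- The inverse of a series `f` with constant term `1`, determined by `f * inv f = 1`. -/
def inv (f : NCSeries d) : NCSeries d
  | [] => 1
  | i :: u => -∑ k ∈ Finset.range (u.length + 1), f (i :: u.take k) * inv f (u.drop k)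
termination_by u => u.length
decreasing_by simp

/-- The left partial derivative `D_i`. -/
def D (i : Fin d) (f : NCSeries d) : NCSeries d := fun u => f (i :: u)

/-- The substitution `f(A z) = f(A z₁, …, A z_d)`, for which
`f(A z) = f(0) + ∑ i, A z_i (D_i f)(A z)`. -/
def subst (A : NCSeries d) (f : NCSeries d) (u : List (Fin d)) : ℂ :=
  (if u = [] then f [] else 0) +
    ∑ k : Fin u.length, A (u.take k) * subst A (D (u.get k) f) (u.drop (k + 1))
termination_by u.length
decreasing_by
  have := k.isLt
  simp only [List.length_drop]; omega

theorem mul_inv (f : NCSeries d) (hf : f [] = 1) : mul f (inv f) = one := by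
  funext u
  cases u with
  | nil => simp [mul, inv, one, hf]
  | cons i u =>
    simp [mul, one, Finset.sum_range_succ' _ (u.length + 1), hf]
    rw [inv]; ring

/-- An equation `f u = F f u` whose right side only involves the values of `f` on words shorter
than `u` has a unique solution. -/
theorem existsUnique_fix (F : NCSeries d → NCSeries d)
    (hF : ∀ f g u, (∀ v, v.length < u.length → f v = g v) → F f u = F g u) :
    ∃! f : NCSeries d, ∀ u, f u = F f u := by
  have step : ∀ n (u : List (Fin d)), u.length < n → F^[n + 1] 0 u = F^[n] 0 u := by
    intro n
    induction n with
    | zero => intro u hu; omega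
    | succ n ih =>
      intro u hu
      have h := hF (F^[n + 1] 0) (F^[n] 0) u fun v hv => ih v (by omega)
      rwa [← Function.iterate_succ_apply' F, ← Function.iterate_succ_apply' F] at h
  have stable : ∀ n (u : List (Fin d)), u.length < n → F^[n] 0 u = F^[u.length + 1] 0 u := by
    intro n u hu
    obtain ⟨k, rfl⟩ := Nat.exists_eq_add_of_lt hu
    induction k with
    | zero => rfl
    | succ k ih =>
      rw [← ih (by omega)]
      exact step (u.length + k + 1) u (by omega)
  refine ⟨fun u => F^[u.length + 1] 0 u, fun u => ?_, fun g hg => ?_⟩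
  · change F^[u.length + 1] 0 u = _
    rw [Function.iterate_succ_apply']
    exact hF _ _ _ fun v hv => stable _ v hv
  · have hn : ∀ n (u : List (Fin d)), u.length < n → g u = F^[n] 0 u := by
      intro n
      induction n with
      | zero => intro u hu; omega
      | succ n ih =>
        intro u hu
        rw [hg, Function.iterate_succ_apply']
        exact hF _ _ _ fun v hv => ih v (by omega)
    funext u
    exact hn _ u (by omega)

theorem subst_congr {A B f g : NCSeries d} (u : List (Fin d))
    (hA : ∀ v, v.length < u.length → A v = B v) (hf : ∀ v, v.length ≤ u.length → f v = g v) :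
    subst A f u = subst B g u := by
  rw [subst, subst]
  have h0 : f [] = g [] := hf [] (by simp)
  rw [h0]
  congr 1
  refine Finset.sum_congr rfl fun k _ => ?_
  have hk := k.isLt
  rw [hA _ (by simp), subst_congr (u.drop (k + 1))]
  · intro v hv
    exact hA v (by simp at hv; omega)
  · intro v hv
    exact hf _ (by simp at hv ⊢; omega)
termination_by u.length
decreasing_by
  have := k.isLt
  simp only [List.length_drop]; omega

/-- The coefficient of `f(A z)` at `u` is `f u` plus terms with values of `f` on shorter words. -/
theorem subst_sub_congr {A f g : NCSeries d} (hA : A [] = 1) (u : List (Fin d))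
    (hf : ∀ v, v.length < u.length → f v = g v) :
    subst A f u - f u = subst A g u - g u := by
  induction u generalizing f g with
  | nil => rw [subst, subst]; simp
  | cons i u ih =>
    rw [subst, subst]
    have h1 : subst A (D i f) u - f (i :: u) = subst A (D i g) u - g (i :: u) :=
      ih fun v hv => hf _ (by simpa using hv)
    have h2 : ∀ k : Fin u.length,
        subst A (D (u.get k) f) (u.drop (k + 1)) = subst A (D (u.get k) g) (u.drop (k + 1)) := by
      intro k
      have hk := k.isLt
      exact subst_congr _ (fun _ _ => rfl) fun v hv => hf _ (by simp at hv ⊢; omega)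
    simp only [List.length_cons, Fin.sum_univ_succ]
    simp only [List.get_eq_getElem] at h2
    simp [hA, h2]
    linear_combination h1

/-- Existence and uniqueness of the series `R` with `R(0) = 0` and `M(w) = R((1 + M(w)) w)`. -/
theorem existsUnique_cumulants (M : NCSeries d) (hM : M [] = 0) :
    ∃! R : NCSeries d, R [] = 0 ∧ ∀ u, u ≠ [] → M u = subst (one + M) R u := by
  have h1 : (one + M : NCSeries d) [] = 1 := by simp [one, hM]
  obtain ⟨R, hR, huniq⟩ := existsUnique_fix
    (fun (R : NCSeries d) u => if u = [] then 0 else M u - (subst (one + M) R u - R u))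
    (fun f g u h => by rw [subst_sub_congr h1 u h])
  refine ⟨R, ⟨by simpa using hR [], fun u hu => ?_⟩, fun S hS => huniq S fun u => ?_⟩
  · have := hR u
    simp only [hu, if_false] at this
    linear_combination -this
  · by_cases hu : u = []
    · simp [hu, hS.1]
    · simp only [hu, if_false]
      linear_combination -(hS.2 u hu)

/-- Existence and uniqueness of the series `M` with `M(0) = 0` and `M(w) = R((1 + M(w)) w)`. -/
theorem existsUnique_moments (R : NCSeries d) :
    ∃! M : NCSeries d, M [] = 0 ∧ ∀ u, u ≠ [] → M u = subst (one + M) R u := by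
  obtain ⟨M, hM, huniq⟩ := existsUnique_fix
    (fun (M : NCSeries d) u => if u = [] then 0 else subst (one + M) R u)
    (fun f g u h => by
      simp only [subst_congr (A := one + f) (B := one + g) u
        (fun v hv => by simp [h v hv]) (fun _ _ => rfl)])
  refine ⟨M, ⟨by simpa using hM [], fun u hu => by simpa [hu] using hM u⟩,
    fun S hS => huniq S fun u => ?_⟩
  by_cases hu : u = []
  · simp [hu, hS.1]
  · simpa [hu] using hS.2 u hu

end NCSeries

/-! ### Moments, cumulants, convolutions and the maps `Φ` and `𝔹` -/

variable {d : ℕ}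

open NCSeries

/-- The moment `φ[x_u]`. -/
def moment (φ : Functional d) (u : List (Fin d)) : ℂ := φ (monomial u)

/-- The moment generating function `M^φ`, without constant term. -/
def momentSeries (φ : Functional d) : NCSeries d := fun u => if u = [] then 0 else moment φ u

theorem momentSeries_nil (φ : Functional d) : momentSeries φ [] = 0 := by simp [momentSeries]

/-- The linear functional with `x_u ↦ m u`. -/
def ofMoments (m : NCSeries d) : Functional d :=
  Finsupp.linearCombination ℂ (fun u : FreeMonoid (Fin d) => m u.toList) ∘ₗ
    (MonoidAlgebra.coeffLinearEquiv ℂ).toLinearMap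

theorem moment_ofMoments (m : NCSeries d) (u : List (Fin d)) : moment (ofMoments m) u = m u := by
  simp [moment, ofMoments, monomial]

/-- The Boolean cumulant generating function `η^φ = 1 - (1 + M^φ)⁻¹`. -/
def booleanCumulants (φ : Functional d) : NCSeries d := one - inv (one + momentSeries φ)

/-- The unital functional with given Boolean cumulant generating function `η` (where `η(0) = 0`),
that is `1 + M = (1 - η)⁻¹`. -/
def ofBooleanCumulants (η : NCSeries d) : Functional d := ofMoments (inv (one - η))

/-- The free cumulant generating function `R^φ`, determined by `R(0) = 0` and
`M^φ(w) = R^φ((1 + M^φ(w)) w)`. -/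
def freeCumulants (φ : Functional d) : NCSeries d :=
  (existsUnique_cumulants (momentSeries φ) (momentSeries_nil φ)).choose

/-- The unital functional with given free cumulant generating function `R` (where `R(0) = 0`),
that is `M(w) = R((1 + M(w)) w)`. -/
def ofFreeCumulants (R : NCSeries d) : Functional d :=
  ofMoments (one + (existsUnique_moments R).choose)

/-- The free convolution `φ ⊞ ψ`. -/
def freeConv (φ ψ : Functional d) : Functional d :=
  ofFreeCumulants (freeCumulants φ + freeCumulants ψ)

/-- The free convolution power `φ^{⊞ t}`. -/
def freePow (φ : Functional d) (t : ℝ) : Functional d :=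
  ofFreeCumulants ((t : ℂ) • freeCumulants φ)

/-- Freely infinitely divisible states: all `ρ^{⊞ t}`, `t ≥ 0`, are states. -/
structure IsFreelyInfDivState (ρ : Functional d) : Prop where
  isState : IsState ρ
  isState_freePow : ∀ t : ℝ, 0 ≤ t → IsState (freePow ρ t)

/-- The functional `Φ[ρ, ψ]`, with
`η^{Φ[ρ, ψ]}(w) = (1 + M^ψ(w))⁻¹ R^ρ((1 + M^ψ(w)) w)`. -/
def Phi (ρ ψ : Functional d) : Functional d :=
  ofBooleanCumulants
    (mul (inv (one + momentSeries ψ)) (subst (one + momentSeries ψ) (freeCumulants ρ)))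

/-- The Boolean-to-free Bercovici-Pata bijection `𝔹`, with `R^{𝔹[φ]} = η^φ`. -/
def BercoviciPata (φ : Functional d) : Functional d := ofFreeCumulants (booleanCumulants φ)


/-! ### Operators and representations -/

section Operators

variable {E F 𝓗 : Type*} [NormedAddCommGroup E] [InnerProductSpace ℂ E]
  [NormedAddCommGroup F] [InnerProductSpace ℂ F] [NormedAddCommGroup 𝓗] [InnerProductSpace ℂ 𝓗]

/-- The rank one operator `x ↦ ⟨w, x⟩ v`. -/
def ketBra (v w : E) : Module.End ℂ E := (innerₛₗ ℂ w).smulRight v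

/-- The orthogonal projection `x ↦ ⟨v, x⟩ v` onto the line of a unit vector `v`. -/
def proj (v : E) : Module.End ℂ E := ketBra v v

/-- The product `X_{u(1)} X_{u(2)} ⋯ X_{u(n)}`. -/
def word (X : Fin d → Module.End ℂ E) (u : List (Fin d)) : Module.End ℂ E := (u.map X).prod

/-- The functional `φ` is represented on the Hilbert space `𝓗` by the operators `X_i` and the unit
vector `v`, that is `φ[x_u] = ⟨v, X_u v⟩`. The `X_i` are symmetric operators on a common invariant
dense domain containing `v`; this domain is the image of `E` under the isometry `J`. -/
structure IsRepresentedOn (φ : Functional d) (J : E →ₗᵢ[ℂ] 𝓗) (X : Fin d → Module.End ℂ E)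
    (v : E) : Prop where
  denseRange : DenseRange J
  isSymmetric : ∀ i, (X i).IsSymmetric
  norm_eq_one : ‖v‖ = 1
  moment_eq : ∀ u, moment φ u = ⟪J v, J (word X u v)⟫_ℂ

end Operators

/-! ### Hilbert space tensor products -/

section HilbertTensor

variable {E E' F F' : Type*} [NormedAddCommGroup E] [InnerProductSpace ℂ E]
  [NormedAddCommGroup E'] [InnerProductSpace ℂ E']
  [NormedAddCommGroup F] [InnerProductSpace ℂ F] [NormedAddCommGroup F'] [InnerProductSpace ℂ F']

/-- The Hilbert space tensor product, the completion of the algebraic tensor product. -/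
abbrev HilbertTensor (E F : Type*) [NormedAddCommGroup E] [InnerProductSpace ℂ E]
    [NormedAddCommGroup F] [InnerProductSpace ℂ F] : Type _ :=
  UniformSpace.Completion (E ⊗[ℂ] F)

/-- The inclusion of the algebraic tensor product of two domains. -/
def HilbertTensor.incl (J : E →ₗᵢ[ℂ] F) (J' : E' →ₗᵢ[ℂ] F') :
    E ⊗[ℂ] E' →ₗᵢ[ℂ] HilbertTensor F F' :=
  UniformSpace.Completion.toComplₗᵢ.comp (TensorProduct.mapIsometry J J')

end HilbertTensor

/-! ### Boolean Fock spaces -/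

section BooleanFock

variable {E F : Type*} [NormedAddCommGroup E] [InnerProductSpace ℂ E]
  [NormedAddCommGroup F] [InnerProductSpace ℂ F]

/-- The Boolean Fock space `ℂΩ ⊕ E`. -/
abbrev BooleanFock (E : Type*) : Type _ := WithLp 2 (ℂ × E)

namespace BooleanFock

/-- The inclusion of `E` into `ℂΩ ⊕ E`. -/
def of (x : E) : BooleanFock E := WithLp.toLp 2 (0, x)

/-- The vacuum vector `Ω`. -/
def vacuum (E : Type*) [NormedAddCommGroup E] : BooleanFock E := WithLp.toLp 2 (1, 0)

/-- The creation operator `x ↦ ⟨Ω, x⟩ ζ`. -/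
def create (ζ : E) : Module.End ℂ (BooleanFock E) := ketBra (of ζ) (vacuum E)

/-- The annihilation operator `x ↦ ⟨ζ, x⟩ Ω`. -/
def annihilate (ζ : E) : Module.End ℂ (BooleanFock E) := ketBra (vacuum E) (of ζ)

/-- The extension of an operator `S` on `E` to `ℂΩ ⊕ E` by `S Ω = 0`. -/
def extend (S : Module.End ℂ E) : Module.End ℂ (BooleanFock E) where
  toFun x := of (S x.snd)
  map_add' x y := by
    apply (WithLp.ofLp_injective 2)
    ext <;> simp [of]
  map_smul' c x := by
    apply (WithLp.ofLp_injective 2)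
    ext <;> simp [of]

/-- The inclusion of the Boolean Fock space over a domain. -/
def incl (J : E →ₗᵢ[ℂ] F) : BooleanFock E →ₗᵢ[ℂ] BooleanFock F where
  toFun x := WithLp.toLp 2 (x.fst, J x.snd)
  map_add' x y := by
    apply (WithLp.ofLp_injective 2)
    ext <;> simp
  map_smul' c x := by
    apply (WithLp.ofLp_injective 2)
    ext <;> simp
  norm_map' x := by simp [WithLp.prod_norm_eq_of_L2]

/-- The operators `a^{b,+}_{ζ_i} + a^{b,-}_{ζ_i} + S_i + α_i P_Ω`. -/
def op (ζ : Fin d → E) (S : Fin d → Module.End ℂ E) (α : Fin d → ℝ) (i : Fin d) :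
    Module.End ℂ (BooleanFock E) :=
  create (ζ i) + annihilate (ζ i) + extend (S i) + (α i : ℂ) • proj (vacuum E)

end BooleanFock

end BooleanFock

/-! ### Full Fock spaces -/

/-- A complex inner product space, bundled. -/
structure PreHilbert : Type (u + 1) where
  carrier : Type u
  [group : NormedAddCommGroup carrier]
  [inner : InnerProductSpace ℂ carrier]

attribute [instance] PreHilbert.group PreHilbert.inner

/-- Algebraic tensor powers, `E^{⊗ 0} = ℂ` (in the universe of `E`), `E^{⊗ (n+1)} = E ⊗ E^{⊗ n}`. -/
def tensorPower (E : Type u) [NormedAddCommGroup E] [InnerProductSpace ℂ E] : ℕ → PreHilbert.{u}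
  | 0 => ⟨EuclideanSpace ℂ PUnit.{u + 1}⟩
  | n + 1 => ⟨E ⊗[ℂ] (tensorPower E n).carrier⟩

/-- The algebraic tensor power `E^{⊗ n}`. -/
abbrev TPow (E : Type u) [NormedAddCommGroup E] [InnerProductSpace ℂ E] (n : ℕ) : Type u :=
  (tensorPower E n).carrier

section FullFock

variable {E : Type u} [NormedAddCommGroup E] [InnerProductSpace ℂ E]
  {F : Type v} [NormedAddCommGroup F] [InnerProductSpace ℂ F]

/-- The identity `E ⊗ E^{⊗ n} = E^{⊗ (n+1)}`. -/
def TPow.consEquiv (E : Type u) [NormedAddCommGroup E] [InnerProductSpace ℂ E] (n : ℕ) :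
    E ⊗[ℂ] TPow E n ≃ₗᵢ[ℂ] TPow E (n + 1) :=
  LinearIsometryEquiv.refl ℂ (E ⊗[ℂ] TPow E n)

/-- The identity `ℂ = E^{⊗ 0}`. -/
def TPow.zeroEquiv (E : Type u) [NormedAddCommGroup E] [InnerProductSpace ℂ E] :
    EuclideanSpace ℂ PUnit.{u + 1} ≃ₗᵢ[ℂ] TPow E 0 :=
  LinearIsometryEquiv.refl ℂ (EuclideanSpace ℂ PUnit.{u + 1})

/-- The map `J^{⊗ n}`. -/
def TPow.map (J : E →ₗᵢ[ℂ] F) : (n : ℕ) → TPow E n →ₗᵢ[ℂ] TPow F n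
  | 0 => ((TPow.zeroEquiv E).symm.trans
      ((LinearIsometryEquiv.piLpCongrLeft 2 ℂ ℂ (Equiv.equivPUnit PUnit.{u + 1})).trans
        (TPow.zeroEquiv F))).toLinearIsometry
  | n + 1 => (TPow.consEquiv F n).toLinearIsometry.comp
      ((TensorProduct.mapIsometry J (TPow.map J n)).comp
        (TPow.consEquiv E n).symm.toLinearIsometry)

/-- The algebraic full Fock space `ℂΩ ⊕ ⨁_{n ≥ 1} E^{⊗ n}`. -/
def AlgFock (E : Type u) [NormedAddCommGroup E] [InnerProductSpace ℂ E] : Type u :=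
  ⨁ n, TPow E n

instance : AddCommGroup (AlgFock E) := inferInstanceAs (AddCommGroup (⨁ n, TPow E n))

instance : Module ℂ (AlgFock E) := inferInstanceAs (Module ℂ (⨁ n, TPow E n))

namespace AlgFock

/-- The component in `E^{⊗ n}`. -/
def component (n : ℕ) : AlgFock E →ₗ[ℂ] TPow E n := DirectSum.component ℂ ℕ (fun n => TPow E n) n

/-- The inclusion of `E^{⊗ n}`. -/
def of (n : ℕ) : TPow E n →ₗ[ℂ] AlgFock E := DirectSum.lof ℂ ℕ (fun n => TPow E n) n

theorem component_of_self (n : ℕ) (x : TPow E n) : component n (of n x) = x :=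
  DirectSum.component.lof_self ℂ (M := fun n => TPow E n) n x

theorem component_of_ne {m n : ℕ} (h : m ≠ n) (x : TPow E m) : component n (of m x) = 0 :=
  (DirectSum.component.of ℂ (M := fun n => TPow E n) n m x).trans (dif_neg h)

theorem hom_ext {V : Type*} [AddCommGroup V] [Module ℂ V] {f g : AlgFock E →ₗ[ℂ] V}
    (h : ∀ n x, f (of n x) = g (of n x)) : f = g :=
  DirectSum.linearMap_ext ℂ fun n => LinearMap.ext fun x => h n x

/-- The linear map on `ℂΩ ⊕ ⨁_{n ≥ 1} E^{⊗ n}` with given restrictions to the summands. -/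
def lift {V : Type*} [AddCommGroup V] [Module ℂ V] (f : (n : ℕ) → TPow E n →ₗ[ℂ] V) :
    AlgFock E →ₗ[ℂ] V :=
  DirectSum.toModule ℂ ℕ V f

theorem lift_of {V : Type*} [AddCommGroup V] [Module ℂ V] (f : (n : ℕ) → TPow E n →ₗ[ℂ] V)
    (n : ℕ) (x : TPow E n) : lift f (of n x) = f n x :=
  DirectSum.toModule_lof ℂ (M := fun n => TPow E n) n x

theorem finite_support (x : AlgFock E) : {n | component n x ≠ 0}.Finite :=
  DFinsupp.finite_support (β := fun n => TPow E n) x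

theorem finite_support_inner (x y : AlgFock E) :
    (Function.support fun n => ⟪component n x, component n y⟫_ℂ).Finite :=
  (finite_support x).subset fun n hn h => hn (by simp [h])

/-- The inner product for which the tensor powers are orthogonal. -/
abbrev core : InnerProductSpace.Core ℂ (AlgFock E) where
  inner x y := ∑ᶠ n, ⟪component n x, component n y⟫_ℂ
  conj_inner_symm x y := by
    rw [map_finsum _ (finite_support_inner y x)]
    simp
  re_inner_nonneg x := by
    have := map_finsum Complex.reAddGroupHom (finite_support_inner x x)
    simp only [Complex.coe_reAddGroupHom] at this
    change 0 ≤ (∑ᶠ n, ⟪component n x, component n x⟫_ℂ).re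
    rw [this]
    exact finsum_nonneg fun n => inner_self_nonneg (𝕜 := ℂ)
  add_left x y z := by
    rw [← finsum_add_distrib (finite_support_inner x z) (finite_support_inner y z)]
    simp
  smul_left x y r := by
    rw [← smul_eq_mul, smul_finsum]
    simp [mul_comm]
  definite x hx := by
    have h := map_finsum Complex.reAddGroupHom (finite_support_inner x x)
    change (∑ᶠ n, ⟪component n x, component n x⟫_ℂ) = 0 at hx
    rw [hx] at h
    refine DFinsupp.ext (β := fun n => TPow E n) fun n => ?_
    by_contra hn
    have hpos : 0 < ∑ᶠ n, (⟪component n x, component n x⟫_ℂ).re :=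
      finsum_pos (fun n => inner_self_nonneg (𝕜 := ℂ))
        ⟨n, by
          have : component n x ≠ 0 := hn
          rw [inner_self_eq_norm_sq_to_K]
          norm_cast
          exact pow_pos (norm_pos_iff.mpr this) 2⟩
        ((finite_support x).subset fun n hn h => hn (by simp [h]))
    simp only [Complex.coe_reAddGroupHom, Complex.zero_re] at h
    exact hpos.ne h

instance : NormedAddCommGroup (AlgFock E) := core.toNormedAddCommGroup

instance : InnerProductSpace ℂ (AlgFock E) := InnerProductSpace.ofCore core.toCore

theorem inner_def (x y : AlgFock E) : ⟪x, y⟫_ℂ = ∑ᶠ n, ⟪component n x, component n y⟫_ℂ := rfl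

/-- The vacuum vector `Ω`. -/
def vacuum (E : Type u) [NormedAddCommGroup E] [InnerProductSpace ℂ E] : AlgFock E :=
  of 0 (TPow.zeroEquiv E (EuclideanSpace.single PUnit.unit 1))

/-- The creation operator `x₁ ⊗ ⋯ ⊗ x_n ↦ ζ ⊗ x₁ ⊗ ⋯ ⊗ x_n`. -/
def create (ζ : E) : Module.End ℂ (AlgFock E) :=
  lift fun n => of (n + 1) ∘ₗ (TPow.consEquiv E n).toLinearEquiv.toLinearMap ∘ₗ
    TensorProduct.mk ℂ E (TPow E n) ζ

/-- The annihilation operator `x₁ ⊗ ⋯ ⊗ x_n ↦ ⟨ζ, x₁⟩ x₂ ⊗ ⋯ ⊗ x_n`, `Ω ↦ 0`. -/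
def annihilate (ζ : E) : Module.End ℂ (AlgFock E) :=
  lift fun
    | 0 => 0
    | n + 1 => of n ∘ₗ (TensorProduct.lid ℂ (TPow E n)).toLinearMap ∘ₗ
        (innerₛₗ ℂ ζ).rTensor (TPow E n) ∘ₗ (TPow.consEquiv E n).symm.toLinearEquiv.toLinearMap

/-- The gauge operator `p(H) : x₁ ⊗ ⋯ ⊗ x_n ↦ (H x₁) ⊗ x₂ ⊗ ⋯ ⊗ x_n`, `Ω ↦ 0`. -/
def gauge (H : Module.End ℂ E) : Module.End ℂ (AlgFock E) :=
  lift fun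
    | 0 => 0
    | n + 1 => of (n + 1) ∘ₗ (TPow.consEquiv E n).toLinearEquiv.toLinearMap ∘ₗ
        H.rTensor (TPow E n) ∘ₗ (TPow.consEquiv E n).symm.toLinearEquiv.toLinearMap

/-- The operators `a^{f,+}_{ζ_i} + a^{f,-}_{ζ_i} + p(H_i) + λ_i I`. -/
def op (ζ : Fin d → E) (H : Fin d → Module.End ℂ E) (lam : Fin d → ℝ) (i : Fin d) :
    Module.End ℂ (AlgFock E) :=
  create (ζ i) + annihilate (ζ i) + gauge (H i) + (lam i : ℂ) • 1

/-- The map `⨁ J^{⊗ n}`. -/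
def map (J : E →ₗᵢ[ℂ] F) : AlgFock E →ₗᵢ[ℂ] AlgFock F :=
  LinearMap.isometryOfInner (lift fun n => of n ∘ₗ (TPow.map J n).toLinearMap) fun x y => by
    have h : ∀ (n : ℕ) (x : AlgFock E),
        component n (lift (fun n => of n ∘ₗ (TPow.map J n).toLinearMap) x : AlgFock F) =
          TPow.map J n (component n x) := by
      intro n x
      have : component n ∘ₗ (lift (fun n => of n ∘ₗ (TPow.map J n).toLinearMap) :
          AlgFock E →ₗ[ℂ] AlgFock F) = (TPow.map J n).toLinearMap ∘ₗ component n := by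
        refine hom_ext fun m z => ?_
        simp only [LinearMap.comp_apply, lift_of]
        by_cases hmn : m = n
        · subst hmn
          rw [component_of_self, component_of_self]
        · rw [component_of_ne hmn, component_of_ne hmn, map_zero]
      exact LinearMap.congr_fun this x
    rw [inner_def, inner_def]
    simp only [h, LinearIsometry.inner_map_map]

end AlgFock

/-- The full Fock space `𝓕(E)`, the completion of `ℂΩ ⊕ ⨁_{n ≥ 1} E^{⊗ n}`. -/
abbrev FullFock (E : Type u) [NormedAddCommGroup E] [InnerProductSpace ℂ E] : Type u :=
  UniformSpace.Completion (AlgFock E)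

/-- The inclusion of the algebraic full Fock space over a domain. -/
def FullFock.incl (J : E →ₗᵢ[ℂ] F) : AlgFock E →ₗᵢ[ℂ] FullFock F :=
  UniformSpace.Completion.toComplₗᵢ.comp (AlgFock.map J)

end FullFock

/-! ### The data representing states -/

section Data

/-- Data `(𝒦, ξ, K_i)`: a unit vector `ξ` and symmetric operators `K_i` with a common invariant
dense domain `dom` containing `ξ`. -/
structure VectorData (d : ℕ) (𝒦 : Type u) [NormedAddCommGroup 𝒦] [InnerProductSpace ℂ 𝒦] where
  dom : Submodule ℂ 𝒦
  dense : Dense (dom : Set 𝒦)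
  ξ : dom
  norm_ξ : ‖ξ‖ = 1
  K : Fin d → Module.End ℂ dom
  symm : ∀ i, (K i).IsSymmetric

/-- Data `(ℋ, ζ_i, H_i, λ_i)`: vectors `ζ_i`, symmetric operators `H_i` with a common invariant
dense domain `dom` containing the `ζ_i`, and real numbers `λ_i`. -/
structure FockData (d : ℕ) (ℋ : Type u) [NormedAddCommGroup ℋ] [InnerProductSpace ℂ ℋ] where
  dom : Submodule ℂ ℋ
  dense : Dense (dom : Set ℋ)
  ζ : Fin d → dom
  H : Fin d → Module.End ℂ dom
  symm : ∀ i, (H i).IsSymmetric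
  lam : Fin d → ℝ

variable {𝒦 : Type u} [NormedAddCommGroup 𝒦] [InnerProductSpace ℂ 𝒦]
  {ℋ : Type v} [NormedAddCommGroup ℋ] [InnerProductSpace ℂ ℋ]

/-- `ψ[x_u] = ⟨ξ, K_u ξ⟩`. -/
def VectorData.Represents (A : VectorData d 𝒦) (ψ : Functional d) : Prop :=
  IsRepresentedOn ψ A.dom.subtypeₗᵢ A.K A.ξ

/-- `φ[x_u] = ⟨Ω, (a^{b,+}_{ε_i} + a^{b,-}_{ε_i} + S_i + α_i P_Ω)_u Ω⟩` on the Boolean Fock space,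
where the data are `(ε_i, S_i, α_i)`. -/
def FockData.BooleanRepresents (B : FockData d ℋ) (φ : Functional d) : Prop :=
  IsRepresentedOn φ (BooleanFock.incl B.dom.subtypeₗᵢ) (BooleanFock.op B.ζ B.H B.lam)
    (BooleanFock.vacuum B.dom)

/-- `ρ[x_u] = ⟨Ω, (a^{f,+}_{ζ_i} + a^{f,-}_{ζ_i} + p(H_i) + λ_i I)_u Ω⟩` on the full Fock space. -/
def FockData.FreeRepresents (B : FockData d ℋ) (ρ : Functional d) : Prop :=
  IsRepresentedOn ρ (FullFock.incl B.dom.subtypeₗᵢ) (AlgFock.op B.ζ B.H B.lam)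
    (AlgFock.vacuum B.dom)

/-- The inclusion of the algebraic tensor product of the domains into `𝒦 ⊗ ℋ`. -/
def tensorIncl (A : VectorData d 𝒦) (B : FockData d ℋ) :
    A.dom ⊗[ℂ] B.dom →ₗᵢ[ℂ] HilbertTensor 𝒦 ℋ :=
  HilbertTensor.incl A.dom.subtypeₗᵢ B.dom.subtypeₗᵢ

/-- The vectors `ξ ⊗ ζ_i`. -/
def tensorVec (A : VectorData d 𝒦) (B : FockData d ℋ) (i : Fin d) : A.dom ⊗[ℂ] B.dom :=
  A.ξ ⊗ₜ[ℂ] B.ζ i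

/-- The operators `K_i ⊗ I + P_ξ ⊗ H_i`. -/
def tensorOp (A : VectorData d 𝒦) (B : FockData d ℋ) (i : Fin d) :
    Module.End ℂ (A.dom ⊗[ℂ] B.dom) :=
  TensorProduct.map (A.K i) LinearMap.id + TensorProduct.map (proj A.ξ) (B.H i)

/-- The inclusion of the domain into `𝓕(𝒦 ⊗ ℋ) ⊗ 𝒦`. -/
def convIncl (A : VectorData d 𝒦) (B : FockData d ℋ) :
    AlgFock (A.dom ⊗[ℂ] B.dom) ⊗[ℂ] A.dom →ₗᵢ[ℂ]
      HilbertTensor (FullFock (HilbertTensor 𝒦 ℋ)) 𝒦 :=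
  HilbertTensor.incl (FullFock.incl (tensorIncl A B)) A.dom.subtypeₗᵢ

/-- The action of `K_i` on the leftmost factor `𝒦` of each summand of
`𝓕(𝒦 ⊗ ℋ) ⊗ 𝒦 = 𝒦 ⊕ ⨁_{n ≥ 1} (𝒦 ⊗ ℋ)^{⊗ n} ⊗ 𝒦`: it is `K_i` on the summand `𝒦`
and `p(K_i ⊗ I) ⊗ I` on the other ones. -/
def leftK (A : VectorData d 𝒦) (B : FockData d ℋ) (i : Fin d) :
    Module.End ℂ (AlgFock (A.dom ⊗[ℂ] B.dom) ⊗[ℂ] A.dom) :=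
  TensorProduct.map (proj (AlgFock.vacuum (A.dom ⊗[ℂ] B.dom))) (A.K i) +
    TensorProduct.map (AlgFock.gauge (TensorProduct.map (A.K i) LinearMap.id)) LinearMap.id

/-- The operators
`a^{f,+}_{ξ ⊗ ζ_i} ⊗ I + a^{f,-}_{ξ ⊗ ζ_i} ⊗ I + p(K_i ⊗ I) ⊗ I + p(P_ξ ⊗ H_i) ⊗ I + λ_i I`
on `𝓕(𝒦 ⊗ ℋ) ⊗ 𝒦`, where the third term is understood as in `leftK`. -/
def convOp (A : VectorData d 𝒦) (B : FockData d ℋ) (i : Fin d) :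
    Module.End ℂ (AlgFock (A.dom ⊗[ℂ] B.dom) ⊗[ℂ] A.dom) :=
  TensorProduct.map (AlgFock.create (tensorVec A B i)) LinearMap.id +
    TensorProduct.map (AlgFock.annihilate (tensorVec A B i)) LinearMap.id +
    leftK A B i +
    TensorProduct.map (AlgFock.gauge (TensorProduct.map (proj A.ξ) (B.H i))) LinearMap.id +
    (B.lam i : ℂ) • 1

end Data

end TwoState

end

/-!
Let vectors `ζ_i`, symmetric operators `H_i` and reals `λ_i` be given, and form the series
`∑ λ_i w_i + ∑ ⟨ζ_i, H_u ζ_j⟩ w_i w_u w_j`. It is the Boolean cumulant series of the operators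
`a⁺ + a⁻ + H + λ P_Ω` on the Boolean Fock space and the free cumulant series of the operators
`a⁺ + a⁻ + p(H) + λ` on the full Fock space, in both cases because a word applied to `Ω` splits at
its first return to `Ω`. Comparing the two cases yields the model of `𝔹[φ]`.

The operators `K_i ⊗ 1 + P_ξ ⊗ H_i` are a monotone sum, so that the moments of `K` at `ξ` get
inserted before every factor: with the vectors `ξ ⊗ ζ_i` the series above becomes
`(1 + M^ψ)⁻¹ R^ρ((1 + M^ψ) w)`, the Boolean cumulant series of `Φ[ρ, ψ]`. The model of `ψ ⊞ ρ` is a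
monotone sum as well, of the free model of `𝔹[Φ[ρ, ψ]]` and of `K`; its moment generating series is
`A(B w) B`, where `A` and `B` are those of `ψ` and of `𝔹[Φ[ρ, ψ]]`. The same factorization holds for
`ψ ⊞ ρ` by uniqueness of the solution of the equation defining free cumulants, and it gives
`𝔹[Φ[ρ, ψ]] = Φ[ρ, ψ ⊞ ρ]`.

Conversely, the GNS construction provides the vector model of a state, and the blocks of its
operators along the cyclic vector and its orthogonal complement form the Boolean model. If `ρ` is
freely infinitely divisible, then `x_u ↦ R^ρ_u` is the derivative of `ρ^{⊞ t}` at `t = 0`, hence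
positive on polynomials without constant term, where its GNS construction provides the free model.
-/

noncomputable section

namespace TwoState

/-! ### The algebra of non-commutative power series -/

namespace NCSeries

variable {d : ℕ}

@[simp] theorem one_nil : (one : NCSeries d) [] = 1 := if_pos rfl

@[simp] theorem one_cons (i : Fin d) (u : List (Fin d)) : (one : NCSeries d) (i :: u) = 0 :=
  if_neg (List.cons_ne_nil i u)

@[simp] theorem D_one (i : Fin d) : D i (one : NCSeries d) = 0 := funext fun u => one_cons i u

@[simp] theorem mul_nil (f g : NCSeries d) : mul f g [] = f [] * g [] := by simp [mul]

theorem mul_apply_cons (f g : NCSeries d) (i : Fin d) (u : List (Fin d)) :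
    mul f g (i :: u) = f [] * g (i :: u) + mul (D i f) g u := by
  rw [mul, List.length_cons, Finset.sum_range_succ', add_comm]
  simp [mul, D]

theorem D_mul (i : Fin d) (f g : NCSeries d) :
    D i (mul f g) = f [] • D i g + mul (D i f) g :=
  funext fun u => mul_apply_cons f g i u

protected theorem mul_add (f g h : NCSeries d) : mul f (g + h) = mul f g + mul f h := by
  funext u; simp [mul, mul_add, Finset.sum_add_distrib]

protected theorem add_mul (f g h : NCSeries d) : mul (f + g) h = mul f h + mul g h := by
  funext u; simp [mul, add_mul, Finset.sum_add_distrib]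

protected theorem mul_sub (f g h : NCSeries d) : mul f (g - h) = mul f g - mul f h := by
  funext u; simp [mul, mul_sub, Finset.sum_sub_distrib]

protected theorem sub_mul (f g h : NCSeries d) : mul (f - g) h = mul f h - mul g h := by
  funext u; simp [mul, sub_mul, Finset.sum_sub_distrib]

protected theorem smul_mul_assoc (c : ℂ) (f g : NCSeries d) : mul (c • f) g = c • mul f g := by
  funext u; simp [mul, Finset.mul_sum, mul_assoc]

protected theorem mul_smul_comm (c : ℂ) (f g : NCSeries d) : mul f (c • g) = c • mul f g := by
  funext u; simp [mul, Finset.mul_sum, mul_left_comm]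

@[simp] protected theorem zero_mul (f : NCSeries d) : mul 0 f = 0 := by
  funext u; simp [mul]

@[simp] protected theorem mul_zero (f : NCSeries d) : mul f 0 = 0 := by
  funext u; simp [mul]

@[simp] protected theorem one_mul (f : NCSeries d) : mul one f = f := by
  funext u
  cases u <;> simp [mul_apply_cons]

@[simp] protected theorem mul_one (f : NCSeries d) : mul f one = f := by
  funext u
  induction u generalizing f with
  | nil => simp
  | cons i u ih => simp [mul_apply_cons, ih, D]

protected theorem mul_assoc (f g h : NCSeries d) : mul (mul f g) h = mul f (mul g h) := by
  funext u
  induction u generalizing f with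
  | nil => simp [mul_assoc]
  | cons i u ih =>
    simp only [mul_apply_cons, D_mul, NCSeries.add_mul, NCSeries.smul_mul_assoc, Pi.add_apply,
      Pi.smul_apply, smul_eq_mul, mul_nil, ih]
    ring

@[simp] theorem inv_nil (f : NCSeries d) : inv f [] = 1 := by rw [inv]

theorem eq_inv_of_mul_eq_one_left {f g : NCSeries d} (hf : f [] = 1) (h : mul g f = one) :
    g = inv f := by
  rw [← NCSeries.mul_one g, ← mul_inv f hf, ← NCSeries.mul_assoc, h, NCSeries.one_mul]

protected theorem inv_inv (f : NCSeries d) (hf : f [] = 1) : inv (inv f) = f :=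
  (eq_inv_of_mul_eq_one_left (inv_nil f) (mul_inv f hf)).symm

theorem inv_mul (f : NCSeries d) (hf : f [] = 1) : mul (inv f) f = one := by
  simpa only [NCSeries.inv_inv f hf] using mul_inv (inv f) (inv_nil f)

protected theorem mul_left_cancel {f g h : NCSeries d} (hf : f [] = 1)
    (H : mul f g = mul f h) : g = h := by
  rw [← NCSeries.one_mul g, ← NCSeries.one_mul h, ← inv_mul f hf, NCSeries.mul_assoc,
    NCSeries.mul_assoc, H]

theorem mul_eq_one_symm {f g : NCSeries d} (hf : f [] = 1) (h : mul g f = one) :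
    mul f g = one := by
  rw [eq_inv_of_mul_eq_one_left hf h, mul_inv f hf]

theorem one_sub_mul_eq_one_iff {f g : NCSeries d} :
    mul (one - f) g = one ↔ g = one + mul f g := by
  rw [NCSeries.sub_mul, NCSeries.one_mul, sub_eq_iff_eq_add]

theorem mul_one_sub_eq_one_iff {f g : NCSeries d} :
    mul g (one - f) = one ↔ g = one + mul g f := by
  rw [NCSeries.mul_sub, NCSeries.mul_one, sub_eq_iff_eq_add]

/-- The series `∑ i, z_i g_i`, in terms of which `f = f(0) + ∑ i, z_i D_i f`. -/
def cons (g : Fin d → NCSeries d) : NCSeries d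
  | [] => 0
  | i :: u => g i u

@[simp] theorem cons_nil (g : Fin d → NCSeries d) : cons g [] = 0 := rfl

@[simp] theorem D_cons (g : Fin d → NCSeries d) (i : Fin d) : D i (cons g) = g i := rfl

theorem eq_smul_one_add_cons (f : NCSeries d) : f = f [] • one + cons fun i => D i f := by
  funext u
  cases u <;> simp [cons, D]

theorem cons_mul (g : Fin d → NCSeries d) (h : NCSeries d) :
    mul (cons g) h = cons fun i => mul (g i) h := by
  funext u
  cases u with
  | nil => simp
  | cons i u => simp [mul_apply_cons, cons]

theorem cons_add (g h : Fin d → NCSeries d) :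
    (cons fun i => g i + h i) = cons g + cons h := by
  funext u; cases u <;> simp [cons]

theorem cons_sub (g h : Fin d → NCSeries d) :
    (cons fun i => g i - h i) = cons g - cons h := by
  funext u; cases u <;> simp [cons]

theorem cons_smul (c : ℂ) (g : Fin d → NCSeries d) :
    (cons fun i => c • g i) = c • cons g := by
  funext u; cases u <;> simp [cons]

theorem mul_cons_apply (A : NCSeries d) (g : Fin d → NCSeries d) (u : List (Fin d)) :
    mul A (cons g) u = ∑ k : Fin u.length, A (u.take k) * g (u.get k) (u.drop (k + 1)) := by
  induction u generalizing A with
  | nil => simp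
  | cons i u ih => rw [mul_apply_cons, ih]; simp [cons, D, Fin.sum_univ_succ]

/-- Each unfolding of the recursion raises the order of the series by one. -/
theorem eq_zero_of_eq_mul_cons {ι : Type*} {A : NCSeries d} {E : ι → NCSeries d}
    {next : Fin d → ι → ι} (hE : ∀ k, E k = mul A (cons fun i => E (next i k))) (k : ι) :
    E k = 0 := by
  funext u
  induction hn : u.length using Nat.strong_induction_on generalizing k u with
  | _ n ih =>
    rw [hE, mul_cons_apply]
    refine Finset.sum_eq_zero fun j _ => ?_
    have hj := j.isLt
    rw [ih _ (by simp only [List.length_drop]; omega) _ _ rfl, Pi.zero_apply, mul_zero]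

theorem eq_of_sub_eq_mul_cons {ι : Type*} {A : NCSeries d} {G H : ι → NCSeries d}
    {next : Fin d → ι → ι}
    (h : ∀ k, G k - H k = mul A (cons fun i => G (next i k) - H (next i k))) (k : ι) :
    G k = H k :=
  sub_eq_zero.1 (eq_zero_of_eq_mul_cons (E := fun k => G k - H k) h k)

theorem subst_eq (A f : NCSeries d) :
    subst A f = f [] • one + mul A (cons fun i => subst A (D i f)) := by
  funext u
  rw [subst, Pi.add_apply, mul_cons_apply]
  simp [one]

@[simp] theorem subst_nil (A f : NCSeries d) : subst A f [] = f [] := by rw [subst]; simp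

theorem subst_of_nil_eq_zero (A : NCSeries d) {f : NCSeries d} (hf : f [] = 0) :
    subst A f = mul A (cons fun i => subst A (D i f)) := by
  rw [subst_eq, hf, zero_smul, zero_add]

theorem subst_add (A f g : NCSeries d) : subst A (f + g) = subst A f + subst A g :=
  eq_of_sub_eq_mul_cons (G := fun p : NCSeries d × NCSeries d => subst A (p.1 + p.2))
    (H := fun p => subst A p.1 + subst A p.2) (next := fun i p => (D i p.1, D i p.2))
    (fun p => by
      have hD (i : Fin d) : D i (p.1 + p.2) = D i p.1 + D i p.2 := rfl
      rw [subst_eq A (p.1 + p.2), subst_eq A p.1, subst_eq A p.2]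
      simp only [hD, cons_sub, cons_add, NCSeries.mul_sub, NCSeries.mul_add, Pi.add_apply,
        add_smul]
      abel) (f, g)

theorem subst_smul (A : NCSeries d) (c : ℂ) (f : NCSeries d) :
    subst A (c • f) = c • subst A f :=
  eq_of_sub_eq_mul_cons (G := fun f => subst A (c • f)) (H := fun f => c • subst A f)
    (next := D)
    (fun f => by
      have hD (i : Fin d) : D i (c • f) = c • D i f := rfl
      rw [subst_eq A (c • f), subst_eq A f]
      simp only [hD, cons_sub, cons_smul, NCSeries.mul_sub, NCSeries.mul_smul_comm, Pi.smul_apply,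
        smul_eq_mul, smul_add, smul_smul]
      abel) f

@[simp] theorem subst_zero (A : NCSeries d) : subst A 0 = 0 := by
  simpa using subst_smul A 0 0

@[simp] theorem subst_one (A : NCSeries d) : subst A one = one := by
  have h : (cons fun _ : Fin d => (0 : NCSeries d)) = 0 := by
    simpa using cons_smul 0 fun _ : Fin d => (0 : NCSeries d)
  rw [subst_eq]
  simp [h]

theorem subst_mul (A f g : NCSeries d) : subst A (mul f g) = mul (subst A f) (subst A g) :=
  eq_of_sub_eq_mul_cons (G := fun f => subst A (mul f g))
    (H := fun f => mul (subst A f) (subst A g)) (next := D)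
    (fun f => by
      have hmul : mul (subst A f) (subst A g) =
          f [] • subst A g + mul A (cons fun i => mul (subst A (D i f)) (subst A g)) := by
        conv_lhs => rw [subst_eq A f]
        rw [NCSeries.add_mul, NCSeries.smul_mul_assoc, NCSeries.one_mul, NCSeries.mul_assoc,
          cons_mul]
      rw [hmul, subst_eq A (mul f g), subst_eq A g]
      simp only [D_mul, subst_add, subst_smul, cons_add, cons_sub, cons_smul, NCSeries.mul_add,
        NCSeries.mul_sub, NCSeries.mul_smul_comm, mul_nil, smul_add, smul_smul]
      abel) f

/-- Replacing `z` by `B z` turns `a z` into `a(B z) B z`. -/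
theorem subst_subst (B a f : NCSeries d) :
    subst B (subst a f) = subst (mul (subst B a) B) f :=
  eq_of_sub_eq_mul_cons (A := mul (subst B a) B) (G := fun f => subst B (subst a f))
    (H := fun f => subst (mul (subst B a) B) f) (next := D)
    (fun f => by
      have hcons (g : Fin d → NCSeries d) :
          subst B (cons g) = mul B (cons fun i => subst B (g i)) :=
        subst_of_nil_eq_zero B (cons_nil g)
      rw [subst_eq a f, subst_eq (mul (subst B a) B) f, subst_add, subst_smul, subst_one,
        subst_mul, hcons, ← NCSeries.mul_assoc, add_sub_add_left_eq_sub, ← NCSeries.mul_sub,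
        ← cons_sub]) f

theorem eq_subst_iff {M R : NCSeries d} (hR : R [] = 0) :
    M = subst (one + M) R ↔ M [] = 0 ∧ ∀ u, u ≠ [] → M u = subst (one + M) R u := by
  refine ⟨fun h => ⟨by rw [h, subst_nil, hR], fun u _ => congrFun h u⟩, fun h => funext fun u => ?_⟩
  rcases eq_or_ne u [] with rfl | hu
  · rw [h.1, subst_nil, hR]
  · exact h.2 u hu

theorem subst_one_left (f : NCSeries d) : subst one f = f :=
  eq_of_sub_eq_mul_cons (A := one) (G := fun f => subst one f) (H := fun f => f) (next := D)
    (fun f => by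
      conv_lhs => enter [2]; rw [eq_smul_one_add_cons f]
      rw [subst_eq, add_sub_add_left_eq_sub, NCSeries.one_mul, NCSeries.one_mul, cons_sub]) f

end NCSeries

open NCSeries Filter Topology

variable {d : ℕ}

/-! ### Cumulants of functionals -/

theorem moment_nil (φ : Functional d) : moment φ [] = φ 1 := rfl

theorem moment_injective : Function.Injective (moment : Functional d → NCSeries d) :=
  fun _ _ h => MonoidAlgebra.lhom_ext' fun u => LinearMap.ext_ring (congrFun h u.toList)

/-- The moment generating function `1 + M^φ`; it is the series of moments if `φ` is unital. -/
def momentGen (φ : Functional d) : NCSeries d := one + momentSeries φ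

@[simp] theorem momentGen_nil (φ : Functional d) : momentGen φ [] = 1 := by
  simp [momentGen, momentSeries_nil]

theorem momentGen_eq_moment {φ : Functional d} (h : φ 1 = 1) : momentGen φ = moment φ := by
  funext u
  cases u <;> simp [momentGen, momentSeries, moment_nil, h]

theorem momentGen_ofMoments {m : NCSeries d} (hm : m [] = 1) : momentGen (ofMoments m) = m :=
  (momentGen_eq_moment ((moment_ofMoments m []).trans hm)).trans (funext (moment_ofMoments m))

theorem freeCumulants_nil (φ : Functional d) : freeCumulants φ [] = 0 :=
  (existsUnique_cumulants (momentSeries φ) (momentSeries_nil φ)).choose_spec.1.1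

theorem momentGen_eq_subst_freeCumulants (φ : Functional d) :
    momentGen φ = one + subst (momentGen φ) (freeCumulants φ) :=
  congrArg (one + ·) <| (eq_subst_iff (freeCumulants_nil φ)).2 ⟨momentSeries_nil φ,
    (existsUnique_cumulants (momentSeries φ) (momentSeries_nil φ)).choose_spec.1.2⟩

theorem freeCumulants_eq {φ : Functional d} {R : NCSeries d} (hR : R [] = 0)
    (h : momentGen φ = one + subst (momentGen φ) R) : freeCumulants φ = R :=
  ((existsUnique_cumulants (momentSeries φ) (momentSeries_nil φ)).choose_spec.2 R
    ⟨hR, ((eq_subst_iff hR).1 (add_left_cancel h)).2⟩).symm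

theorem ofFreeCumulants_one (R : NCSeries d) : ofFreeCumulants R 1 = 1 := by
  rw [← moment_nil, ofFreeCumulants, moment_ofMoments, Pi.add_apply, one_nil,
    (existsUnique_moments R).choose_spec.1.1, add_zero]

theorem momentGen_ofFreeCumulants (R : NCSeries d) :
    momentGen (ofFreeCumulants R) = one + (existsUnique_moments R).choose :=
  momentGen_ofMoments (by rw [Pi.add_apply, one_nil, (existsUnique_moments R).choose_spec.1.1,
    add_zero])

theorem momentGen_ofFreeCumulants_eq_subst {R : NCSeries d} (hR : R [] = 0) :
    momentGen (ofFreeCumulants R) = one + subst (momentGen (ofFreeCumulants R)) R := by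
  rw [momentGen_ofFreeCumulants]
  exact congrArg (one + ·) ((eq_subst_iff hR).2 (existsUnique_moments R).choose_spec.1)

theorem eq_momentGen_ofFreeCumulants {R m : NCSeries d} (hR : R [] = 0)
    (hm : m = one + subst m R) : m = momentGen (ofFreeCumulants R) := by
  have hM : m - one = subst (one + (m - one)) R := by
    rwa [add_sub_cancel, sub_eq_iff_eq_add']
  rw [momentGen_ofFreeCumulants, ← (existsUnique_moments R).choose_spec.2 _
    ((eq_subst_iff hR).1 hM), add_sub_cancel]

theorem freeCumulants_ofFreeCumulants {R : NCSeries d} (hR : R [] = 0) :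
    freeCumulants (ofFreeCumulants R) = R :=
  freeCumulants_eq hR (momentGen_ofFreeCumulants_eq_subst hR)

theorem booleanCumulants_nil (φ : Functional d) : booleanCumulants φ [] = 0 := by
  simp [booleanCumulants]

theorem momentGen_eq_one_add_mul (φ : Functional d) :
    momentGen φ = one + mul (booleanCumulants φ) (momentGen φ) := by
  rw [← one_sub_mul_eq_one_iff, booleanCumulants, sub_sub_cancel]
  exact inv_mul _ (momentGen_nil φ)

theorem booleanCumulants_eq {φ : Functional d} {η : NCSeries d}
    (h : momentGen φ = one + mul η (momentGen φ)) : booleanCumulants φ = η :=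
  sub_eq_of_eq_add (sub_eq_iff_eq_add'.1
    (eq_inv_of_mul_eq_one_left (momentGen_nil φ) (one_sub_mul_eq_one_iff.2 h)))

theorem ofBooleanCumulants_one (η : NCSeries d) : ofBooleanCumulants η 1 = 1 :=
  (moment_ofMoments _ []).trans (inv_nil _)

theorem momentGen_ofBooleanCumulants (η : NCSeries d) :
    momentGen (ofBooleanCumulants η) = inv (one - η) :=
  momentGen_ofMoments (inv_nil _)

theorem booleanCumulants_ofBooleanCumulants {η : NCSeries d} (hη : η [] = 0) :
    booleanCumulants (ofBooleanCumulants η) = η := by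
  refine booleanCumulants_eq (one_sub_mul_eq_one_iff.1 ?_)
  rw [momentGen_ofBooleanCumulants]
  exact NCSeries.mul_inv _ (by simp [hη])

/-- The Boolean cumulants `(1 + M^ψ(w))⁻¹ R^ρ((1 + M^ψ(w)) w)` of `Φ[ρ, ψ]`. -/
def phiCumulants (ρ ψ : Functional d) : NCSeries d :=
  mul (inv (momentGen ψ)) (subst (momentGen ψ) (freeCumulants ρ))

theorem phiCumulants_nil (ρ ψ : Functional d) : phiCumulants ρ ψ [] = 0 := by
  simp [phiCumulants, freeCumulants_nil]

theorem phiCumulants_eq_cons (ρ ψ : Functional d) :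
    phiCumulants ρ ψ = cons fun i => subst (momentGen ψ) (D i (freeCumulants ρ)) := by
  rw [phiCumulants, subst_of_nil_eq_zero _ (freeCumulants_nil ρ), ← NCSeries.mul_assoc,
    inv_mul _ (momentGen_nil ψ), NCSeries.one_mul]

theorem booleanCumulants_Phi (ρ ψ : Functional d) :
    booleanCumulants (Phi ρ ψ) = phiCumulants ρ ψ :=
  booleanCumulants_ofBooleanCumulants (phiCumulants_nil ρ ψ)

theorem freeCumulants_BercoviciPata (φ : Functional d) :
    freeCumulants (BercoviciPata φ) = booleanCumulants φ :=
  freeCumulants_ofFreeCumulants (booleanCumulants_nil φ)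

theorem mul_subst_phiCumulants (ρ ψ : Functional d) (B : NCSeries d) :
    mul (subst B (momentGen ψ)) (subst B (phiCumulants ρ ψ)) =
      subst (mul (subst B (momentGen ψ)) B) (freeCumulants ρ) := by
  rw [← subst_mul, phiCumulants, ← NCSeries.mul_assoc, NCSeries.mul_inv _ (momentGen_nil ψ),
    NCSeries.one_mul, subst_subst]

theorem momentGen_BercoviciPata_Phi (ρ ψ : Functional d) :
    momentGen (BercoviciPata (Phi ρ ψ)) =
      one + subst (momentGen (BercoviciPata (Phi ρ ψ))) (phiCumulants ρ ψ) := by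
  rw [← booleanCumulants_Phi, ← freeCumulants_BercoviciPata]
  exact momentGen_eq_subst_freeCumulants _

/-- Subordination: with `B = 1 + M^{𝔹[Φ[ρ, ψ]]}`, the series `A = (1 + M^ψ)(B z) B` satisfies
`(1 + M^ψ)(B z) = 1 + R^ψ(A z)` and `(1 + M^ψ)(B z) (B - 1) = R^ρ(A z)`. -/
theorem momentGen_freeConv (ψ ρ : Functional d) :
    momentGen (freeConv ψ ρ) = mul (subst (momentGen (BercoviciPata (Phi ρ ψ))) (momentGen ψ))
      (momentGen (BercoviciPata (Phi ρ ψ))) := by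
  have hB := momentGen_BercoviciPata_Phi ρ ψ
  set B := momentGen (BercoviciPata (Phi ρ ψ))
  set A := mul (subst B (momentGen ψ)) B
  have hψ : subst B (momentGen ψ) = one + subst A (freeCumulants ψ) := by
    conv_lhs => rw [momentGen_eq_subst_freeCumulants, subst_add, subst_one, subst_subst]
  refine (eq_momentGen_ofFreeCumulants (by simp [freeCumulants_nil]) ?_).symm
  calc A = mul (subst B (momentGen ψ)) (one + subst B (phiCumulants ρ ψ)) := by rw [← hB]
    _ = subst B (momentGen ψ) + subst A (freeCumulants ρ) := by
      rw [NCSeries.mul_add, NCSeries.mul_one, mul_subst_phiCumulants]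
    _ = one + subst A (freeCumulants ψ + freeCumulants ρ) := by rw [hψ, subst_add, add_assoc]

theorem BercoviciPata_Phi (ρ ψ : Functional d) :
    BercoviciPata (Phi ρ ψ) = Phi ρ (freeConv ψ ρ) := by
  apply moment_injective
  rw [← momentGen_eq_moment (φ := BercoviciPata (Phi ρ ψ)) (ofFreeCumulants_one _),
    ← momentGen_eq_moment (φ := Phi ρ (freeConv ψ ρ)) (ofBooleanCumulants_one _)]
  have hB := momentGen_BercoviciPata_Phi ρ ψ
  have hA := momentGen_freeConv ψ ρ
  have hη : mul (momentGen (BercoviciPata (Phi ρ ψ))) (phiCumulants ρ (freeConv ψ ρ)) =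
      subst (momentGen (BercoviciPata (Phi ρ ψ))) (phiCumulants ρ ψ) := by
    refine NCSeries.mul_left_cancel
      (f := subst (momentGen (BercoviciPata (Phi ρ ψ))) (momentGen ψ)) (by simp) ?_
    rw [mul_subst_phiCumulants, ← NCSeries.mul_assoc, ← hA, phiCumulants, ← NCSeries.mul_assoc,
      NCSeries.mul_inv _ (momentGen_nil _), NCSeries.one_mul]
  refine (eq_inv_of_mul_eq_one_left (by simp [phiCumulants_nil]) ?_).trans
    (momentGen_ofBooleanCumulants (phiCumulants ρ (freeConv ψ ρ))).symm
  rw [mul_one_sub_eq_one_iff, hη, ← hB]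

/-! ### Operators on the algebraic Fock space -/

namespace AlgFock

variable {E : Type u} [NormedAddCommGroup E] [InnerProductSpace ℂ E]
  {F : Type v} [NormedAddCommGroup F] [InnerProductSpace ℂ F]

@[elab_as_elim]
theorem induction_of {p : AlgFock E → Prop} (x : AlgFock E)
    (add : ∀ x y, p x → p y → p (x + y)) (of : ∀ n x, p (of n x)) : p x := by
  refine DirectSum.induction_on (β := fun n => TPow E n) (motive := p) x ?_ (fun n y => of n y)
    (fun x y hx hy => add x y hx hy)
  have h := of 0 0
  rwa [map_zero] at h

theorem create_of (e : E) (n : ℕ) (x : TPow E n) :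
    create e (of n x) = of (n + 1) (TPow.consEquiv E n (e ⊗ₜ x)) := by
  rw [create, lift_of]; rfl

theorem exists_of_zero_eq_smul_vacuum (x : TPow E 0) : ∃ c : ℂ, of 0 x = c • vacuum E := by
  refine ⟨(TPow.zeroEquiv E).symm x PUnit.unit, ?_⟩
  rw [vacuum, ← map_smul, ← map_smul]
  congr 1
  refine (TPow.zeroEquiv E).symm.injective ?_
  ext i
  simp

@[elab_as_elim]
theorem induction_create {p : AlgFock E → Prop} (x : AlgFock E)
    (add : ∀ x y, p x → p y → p (x + y)) (smul : ∀ (c : ℂ) x, p x → p (c • x))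
    (vacuum : p (vacuum E)) (create : ∀ e x, p x → p (create e x)) : p x := by
  induction x using induction_of with
  | add x y hx hy => exact add x y hx hy
  | of n x =>
    induction n with
    | zero =>
      obtain ⟨c, hc⟩ := exists_of_zero_eq_smul_vacuum x
      exact hc ▸ smul c _ vacuum
    | succ n ih =>
      refine TensorProduct.induction_on (motive := fun y : E ⊗[ℂ] TPow E n =>
        p (of (n + 1) (TPow.consEquiv E n y))) ((TPow.consEquiv E n).symm x) ?_ ?_ ?_
      · simpa only [map_zero, zero_smul] using smul 0 _ vacuum
      · exact fun e y => create_of e n y ▸ create e _ (ih y)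
      · intro y z hy hz
        simpa only [map_add] using add _ _ hy hz

@[simp] theorem annihilate_vacuum (ζ : E) : annihilate ζ (vacuum E) = 0 := by
  rw [annihilate, vacuum, lift_of]; rfl

@[simp] theorem gauge_vacuum (H : Module.End ℂ E) : gauge H (vacuum E) = 0 := by
  rw [gauge, vacuum, lift_of]; rfl

theorem create_add (e f : E) (x : AlgFock E) : create (e + f) x = create e x + create f x := by
  induction x using induction_of with
  | add x y hx hy => simp only [map_add, hx, hy]; abel
  | of n x => simp only [create_of, TensorProduct.add_tmul, map_add]

@[simp] theorem annihilate_create (ζ e : E) (x : AlgFock E) :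
    annihilate ζ (create e x) = ⟪ζ, e⟫_ℂ • x := by
  induction x using induction_of with
  | add x y hx hy => simp only [map_add, hx, hy, smul_add]
  | of n x => rw [create_of, annihilate, lift_of, ← map_smul]; simp

@[simp] theorem gauge_create (H : Module.End ℂ E) (e : E) (x : AlgFock E) :
    gauge H (create e x) = create (H e) x := by
  induction x using induction_of with
  | add x y hx hy => simp only [map_add, hx, hy]
  | of n x => rw [create_of, gauge, lift_of, create_of]; simp

theorem gauge_add (H H' : Module.End ℂ E) : gauge (H + H') = gauge H + gauge H' := by
  ext x
  induction x using induction_create with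
  | add x y hx hy => rw [map_add, map_add, hx, hy]
  | smul c x hx => rw [map_smul, map_smul, hx]
  | vacuum => simp
  | create e x _ => simp [create_add]

theorem inner_of_of (n : ℕ) (x y : TPow E n) :
    ⟪(of n x : AlgFock E), of n y⟫_ℂ = ⟪x, y⟫_ℂ := by
  rw [inner_def, finsum_eq_single _ n fun m hm => by
    rw [component_of_ne hm.symm, inner_zero_left], component_of_self, component_of_self]

theorem inner_of_of_ne {m n : ℕ} (h : m ≠ n) (x : TPow E m) (y : TPow E n) :
    ⟪(of m x : AlgFock E), of n y⟫_ℂ = 0 := by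
  rw [inner_def, finsum_eq_single _ m fun k hk => by
    rw [component_of_ne hk.symm, inner_zero_left], component_of_ne h.symm, inner_zero_right]

theorem inner_vacuum_vacuum : ⟪vacuum E, vacuum E⟫_ℂ = 1 := by
  rw [vacuum, inner_of_of, LinearIsometryEquiv.inner_map_map]
  simp

theorem norm_vacuum : ‖vacuum E‖ = 1 := by
  rw [norm_eq_sqrt_re_inner (𝕜 := ℂ), inner_vacuum_vacuum]
  simp

@[simp] theorem inner_vacuum_create (e : E) (x : AlgFock E) : ⟪vacuum E, create e x⟫_ℂ = 0 := by
  induction x using induction_of with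
  | add x y hx hy => rw [map_add, inner_add_right, hx, hy, add_zero]
  | of n x => rw [create_of, vacuum]; exact inner_of_of_ne n.succ_ne_zero.symm _ _

@[simp] theorem inner_create_vacuum (e : E) (x : AlgFock E) : ⟪create e x, vacuum E⟫_ℂ = 0 := by
  rw [← inner_conj_symm, inner_vacuum_create, map_zero]

@[simp] theorem inner_create_create (e f : E) (x y : AlgFock E) :
    ⟪create e x, create f y⟫_ℂ = ⟪e, f⟫_ℂ * ⟪x, y⟫_ℂ := by
  induction x using induction_of with
  | add x x' hx hx' => rw [map_add, inner_add_left, inner_add_left, hx, hx', mul_add]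
  | of m x =>
    induction y using induction_of with
    | add y y' hy hy' => rw [map_add, inner_add_right, inner_add_right, hy, hy', mul_add]
    | of n y =>
      rw [create_of, create_of]
      obtain rfl | h := eq_or_ne m n
      · rw [inner_of_of, inner_of_of, LinearIsometryEquiv.inner_map_map,
          TensorProduct.inner_tmul]
      · rw [inner_of_of_ne h, inner_of_of_ne (by omega), mul_zero]

theorem inner_create_left (ζ : E) (x y : AlgFock E) :
    ⟪create ζ x, y⟫_ℂ = ⟪x, annihilate ζ y⟫_ℂ := by
  induction y using induction_create with
  | add y z hy hz => rw [map_add, inner_add_right, inner_add_right, hy, hz]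
  | smul c y hy => rw [map_smul, inner_smul_right, inner_smul_right, hy]
  | vacuum => simp
  | create e y _ => simp

theorem inner_annihilate_left (ζ : E) (x y : AlgFock E) :
    ⟪annihilate ζ x, y⟫_ℂ = ⟪x, create ζ y⟫_ℂ := by
  rw [← inner_conj_symm, ← inner_create_left, inner_conj_symm]

theorem inner_vacuum_gauge (H : Module.End ℂ E) (x : AlgFock E) :
    ⟪vacuum E, gauge H x⟫_ℂ = 0 := by
  induction x using induction_create with
  | add x y hx hy => rw [map_add, inner_add_right, hx, hy, add_zero]
  | smul c x hx => rw [map_smul, inner_smul_right, hx, mul_zero]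
  | vacuum => simp
  | create e x _ => simp

theorem annihilate_gauge {H : Module.End ℂ E} (hH : H.IsSymmetric) (e : E) (x : AlgFock E) :
    annihilate e (gauge H x) = annihilate (H e) x := by
  induction x using induction_create with
  | add x y hx hy => simp only [map_add, hx, hy]
  | smul c x hx => simp only [map_smul, hx]
  | vacuum => simp
  | create f x _ => simp [hH e f]

theorem gauge_isSymmetric {H : Module.End ℂ E} (hH : H.IsSymmetric) : (gauge H).IsSymmetric := by
  intro x y
  induction x using induction_create with
  | add x z hx hz => rw [map_add, inner_add_left, inner_add_left, hx, hz]
  | smul c x hx => rw [map_smul, inner_smul_left, inner_smul_left, hx]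
  | vacuum => rw [gauge_vacuum, inner_zero_left, inner_vacuum_gauge]
  | create e x _ =>
    rw [gauge_create, inner_create_left, inner_create_left, annihilate_gauge hH]

theorem op_isSymmetric {ζ : Fin d → E} {H : Fin d → Module.End ℂ E}
    (hH : ∀ i, (H i).IsSymmetric) (lam : Fin d → ℝ) (i : Fin d) :
    (op ζ H lam i).IsSymmetric := by
  intro x y
  simp only [op, LinearMap.add_apply, inner_add_left, inner_add_right, inner_create_left,
    inner_annihilate_left, gauge_isSymmetric (hH i) x y, LinearMap.smul_apply,
    Module.End.one_apply, inner_smul_left, inner_smul_right, Complex.conj_ofReal]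
  ring

theorem op_vacuum (ζ : Fin d → E) (H : Fin d → Module.End ℂ E) (lam : Fin d → ℝ) (i : Fin d) :
    op ζ H lam i (vacuum E) = create (ζ i) (vacuum E) + (lam i : ℂ) • vacuum E := by
  simp [op]

theorem op_create (ζ : Fin d → E) (H : Fin d → Module.End ℂ E) (lam : Fin d → ℝ) (i : Fin d)
    (e : E) (x : AlgFock E) :
    op ζ H lam i (create e x) = create (ζ i) (create e x) + ⟪ζ i, e⟫_ℂ • x + create (H i e) x +
      (lam i : ℂ) • create e x := by
  simp [op]

/-- The map `x₁ ⊗ ⋯ ⊗ x_n ↦ x₁ ⊗ ⋯ ⊗ x_n ⊗ k`. -/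
def snoc (k : E) : (n : ℕ) → TPow E n →ₗ[ℂ] TPow E (n + 1)
  | 0 => (TPow.consEquiv E 0).toLinearEquiv.toLinearMap ∘ₗ TensorProduct.mk ℂ E (TPow E 0) k
  | n + 1 => (TPow.consEquiv E (n + 1)).toLinearEquiv.toLinearMap ∘ₗ (snoc k n).lTensor E ∘ₗ
      (TPow.consEquiv E n).symm.toLinearEquiv.toLinearMap

/-- The right creation operator `x₁ ⊗ ⋯ ⊗ x_n ↦ x₁ ⊗ ⋯ ⊗ x_n ⊗ k`. -/
def rightCreate (k : E) : Module.End ℂ (AlgFock E) := lift fun n => of (n + 1) ∘ₗ snoc k n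

@[simp] theorem rightCreate_vacuum (k : E) : rightCreate k (vacuum E) = create k (vacuum E) := by
  rw [rightCreate, vacuum, lift_of, create_of]; rfl

@[simp] theorem rightCreate_create (k e : E) (x : AlgFock E) :
    rightCreate k (create e x) = create e (rightCreate k x) := by
  induction x using induction_of with
  | add x y hx hy => simp only [map_add, hx, hy]
  | of n x =>
    rw [create_of, rightCreate, lift_of, lift_of, LinearMap.comp_apply, LinearMap.comp_apply,
      create_of, snoc]
    simp

theorem inner_rightCreate_vacuum (k : E) (x : AlgFock E) :
    ⟪rightCreate k x, vacuum E⟫_ℂ = 0 := by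
  induction x using induction_create with
  | add x y hx hy => rw [map_add, inner_add_left, hx, hy, add_zero]
  | smul c x hx => rw [map_smul, inner_smul_left, hx, mul_zero]
  | vacuum => simp
  | create e x _ => simp

theorem op_rightCreate (ζ : Fin d → E) (H : Fin d → Module.End ℂ E) (lam : Fin d → ℝ)
    (i : Fin d) (k : E) (x : AlgFock E) :
    op ζ H lam i (rightCreate k x) = rightCreate k (op ζ H lam i x) +
      ⟪vacuum E, x⟫_ℂ • (create (H i k) (vacuum E) + ⟪ζ i, k⟫_ℂ • vacuum E) := by
  induction x using induction_create with
  | add x y hx hy => simp only [map_add, inner_add_right, hx, hy, add_smul]; abel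
  | smul c x hx => simp only [map_smul, inner_smul_right, hx, smul_add, mul_smul]
  | vacuum =>
    simp only [inner_vacuum_vacuum, one_smul, op_vacuum, op_create, rightCreate_vacuum,
      rightCreate_create, map_add, map_smul]
    abel
  | create e x _ => simp [op_create]

theorem map_of (J : E →ₗᵢ[ℂ] F) (n : ℕ) (x : TPow E n) :
    map J (of n x) = of n (TPow.map J n x) :=
  lift_of _ n x

theorem map_vacuum (J : E →ₗᵢ[ℂ] F) : map J (vacuum E) = vacuum F := by
  rw [vacuum, map_of]
  rfl

theorem map_create (J : E →ₗᵢ[ℂ] F) (e : E) (x : AlgFock E) :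
    map J (create e x) = create (J e) (map J x) := by
  induction x using induction_of with
  | add x y hx hy => simp only [map_add, hx, hy]
  | of n x => rw [create_of, map_of, map_of, create_of]; simp [TPow.map]

end AlgFock

/-! ### Cumulants of Boolean and free Fock operators -/

section Cumulants

variable {E F : Type*} [NormedAddCommGroup E] [InnerProductSpace ℂ E]
  [NormedAddCommGroup F] [InnerProductSpace ℂ F]

theorem word_cons (X : Fin d → Module.End ℂ E) (i : Fin d) (u : List (Fin d)) :
    word X (i :: u) = X i * word X u := by simp [word]

/-- The generating series `∑ ⟨x, X_u y⟩ z_u` of the matrix coefficients of the operators `X_i`. -/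
def matrixSeries (X : Fin d → Module.End ℂ E) (x y : E) : NCSeries d :=
  fun u => ⟪x, word X u y⟫_ℂ

@[simp] theorem matrixSeries_nil (X : Fin d → Module.End ℂ E) (x y : E) :
    matrixSeries X x y [] = ⟪x, y⟫_ℂ := rfl

theorem D_matrixSeries {X : Fin d → Module.End ℂ E} (hX : ∀ i, (X i).IsSymmetric) (x y : E)
    (i : Fin d) : D i (matrixSeries X x y) = matrixSeries X (X i x) y :=
  funext fun u => by rw [D, matrixSeries, word_cons, Module.End.mul_apply, ← hX i, matrixSeries]

theorem matrixSeries_cons {X : Fin d → Module.End ℂ E} (hX : ∀ i, (X i).IsSymmetric) (x y : E)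
    (i : Fin d) (u : List (Fin d)) :
    matrixSeries X x y (i :: u) = matrixSeries X (X i x) y u :=
  congrFun (D_matrixSeries hX x y i) u

theorem matrixSeries_eq_smul_one_add_cons {X : Fin d → Module.End ℂ E}
    (hX : ∀ i, (X i).IsSymmetric) (x y : E) :
    matrixSeries X x y = ⟪x, y⟫_ℂ • one + cons fun i => matrixSeries X (X i x) y := by
  conv_lhs => rw [eq_smul_one_add_cons (matrixSeries X x y)]
  simp only [matrixSeries_nil, D_matrixSeries hX]

theorem matrixSeries_add_left (X : Fin d → Module.End ℂ E) (x x' y : E) :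
    matrixSeries X (x + x') y = matrixSeries X x y + matrixSeries X x' y :=
  funext fun _ => inner_add_left _ _ _

theorem matrixSeries_smul_left (X : Fin d → Module.End ℂ E) (c : ℂ) (x y : E) :
    matrixSeries X (c • x) y = conj c • matrixSeries X x y :=
  funext fun _ => inner_smul_left _ _ _

/-- The series `∑ ⟨k, H_u ζ_j⟩ z_u z_j`. The recursion moves the `H_i` to the left of the inner
product, so this reading requires them to be symmetric. -/
def vectorCumulants (ζ : Fin d → E) (H : Fin d → Module.End ℂ E) : E → NCSeries d
  | _, [] => 0
  | k, j :: u => vectorCumulants ζ H (H j k) u + if u = [] then ⟪k, ζ j⟫_ℂ else 0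

/-- The series with coefficients `λ_i` at `z_i` and `⟨ζ_i, H_u ζ_j⟩` at `z_i z_u z_j`: the Boolean
cumulants of `BooleanFock.op ζ H λ` and the free cumulants of `AlgFock.op ζ H λ`. -/
def fockCumulants (ζ : Fin d → E) (H : Fin d → Module.End ℂ E) (lam : Fin d → ℝ) : NCSeries d :=
  cons fun i => vectorCumulants ζ H (ζ i) + (lam i : ℂ) • one

@[simp] theorem vectorCumulants_nil (ζ : Fin d → E) (H : Fin d → Module.End ℂ E) (k : E) :
    vectorCumulants ζ H k [] = 0 := by rw [vectorCumulants]

theorem D_vectorCumulants (ζ : Fin d → E) (H : Fin d → Module.End ℂ E) (k : E) (j : Fin d) :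
    D j (vectorCumulants ζ H k) = vectorCumulants ζ H (H j k) + ⟪k, ζ j⟫_ℂ • one := by
  funext u
  rw [D, vectorCumulants]
  simp [one]

theorem vectorCumulants_add (ζ : Fin d → E) (H : Fin d → Module.End ℂ E) (k l : E) :
    vectorCumulants ζ H (k + l) = vectorCumulants ζ H k + vectorCumulants ζ H l := by
  funext u
  induction u generalizing k l with
  | nil => simp
  | cons j u ih =>
    simp only [Pi.add_apply, vectorCumulants, map_add, ih, inner_add_left]
    split_ifs <;> ring

theorem vectorCumulants_smul (ζ : Fin d → E) (H : Fin d → Module.End ℂ E) (c : ℂ) (k : E) :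
    vectorCumulants ζ H (c • k) = conj c • vectorCumulants ζ H k := by
  funext u
  induction u generalizing k with
  | nil => simp
  | cons j u ih =>
    simp only [Pi.smul_apply, vectorCumulants, map_smul, ih, inner_smul_left, smul_eq_mul]
    split_ifs <;> ring

theorem vectorCumulants_smul_vectors (ζ : Fin d → E) (H : Fin d → Module.End ℂ E) (c : ℂ) (k : E) :
    vectorCumulants (fun i => c • ζ i) H k = c • vectorCumulants ζ H k := by
  funext u
  induction u generalizing k with
  | nil => simp
  | cons j u ih =>
    simp only [Pi.smul_apply, vectorCumulants, ih, inner_smul_right, smul_eq_mul]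
    split_ifs <;> ring

theorem fockCumulants_nil (ζ : Fin d → E) (H : Fin d → Module.End ℂ E) (lam : Fin d → ℝ) :
    fockCumulants ζ H lam [] = 0 := rfl

theorem fockCumulants_sqrt_smul (ζ : Fin d → E) (H : Fin d → Module.End ℂ E) (lam : Fin d → ℝ)
    {t : ℝ} (ht : 0 ≤ t) :
    fockCumulants (fun i => (√t : ℂ) • ζ i) H (fun i => t * lam i) =
      (t : ℂ) • fockCumulants ζ H lam := by
  have hsqrt : (√t : ℂ) * √t = t := by rw [← Complex.ofReal_mul, Real.mul_self_sqrt ht]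
  rw [fockCumulants, fockCumulants, ← cons_smul]
  congr 1
  funext i
  rw [vectorCumulants_smul_vectors, vectorCumulants_smul, smul_smul, Complex.conj_ofReal, hsqrt,
    smul_add, smul_smul, Complex.ofReal_mul]

namespace BooleanFock

theorem inner_eq (x y : BooleanFock E) :
    ⟪x, y⟫_ℂ = y.fst * conj x.fst + ⟪x.snd, y.snd⟫_ℂ := by
  rw [WithLp.prod_inner_apply]; rfl

theorem inner_vacuum_vacuum : ⟪vacuum E, vacuum E⟫_ℂ = 1 := by simp [vacuum]

theorem inner_of_vacuum (x : E) : ⟪of x, vacuum E⟫_ℂ = 0 := by simp [of, vacuum]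

theorem norm_vacuum : ‖vacuum E‖ = 1 := by
  rw [norm_eq_sqrt_re_inner (𝕜 := ℂ), inner_vacuum_vacuum]
  simp

theorem op_apply (ζ : Fin d → E) (S : Fin d → Module.End ℂ E) (α : Fin d → ℝ) (i : Fin d)
    (x : BooleanFock E) : op ζ S α i x =
      WithLp.toLp 2 (⟪ζ i, x.snd⟫_ℂ + α i * x.fst, x.fst • ζ i + S i x.snd) := by
  apply WithLp.ofLp_injective 2
  ext <;> simp [op, create, annihilate, extend, proj, ketBra, of, vacuum]

theorem op_vacuum (ζ : Fin d → E) (S : Fin d → Module.End ℂ E) (α : Fin d → ℝ) (i : Fin d) :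
    op ζ S α i (vacuum E) = of (ζ i) + (α i : ℂ) • vacuum E := by
  rw [op_apply]
  apply WithLp.ofLp_injective 2
  ext <;> simp [of, vacuum]

theorem op_of (ζ : Fin d → E) (S : Fin d → Module.End ℂ E) (α : Fin d → ℝ) (i : Fin d) (k : E) :
    op ζ S α i (of k) = of (S i k) + ⟪ζ i, k⟫_ℂ • vacuum E := by
  rw [op_apply]
  apply WithLp.ofLp_injective 2
  ext <;> simp [of, vacuum]

variable {ζ : Fin d → E} {S : Fin d → Module.End ℂ E}

theorem op_isSymmetric (hS : ∀ i, (S i).IsSymmetric) (α : Fin d → ℝ) (i : Fin d) :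
    (op ζ S α i).IsSymmetric := by
  intro x y
  rw [op_apply, op_apply, inner_eq, inner_eq]
  simp only [WithLp.fst, WithLp.snd, inner_add_left, inner_add_right, map_add, map_mul,
    inner_smul_left, inner_smul_right, inner_conj_symm, Complex.conj_ofReal,
    hS i x.ofLp.2 y.ofLp.2]
  ring

theorem matrixSeries_op_of (hS : ∀ i, (S i).IsSymmetric) (α : Fin d → ℝ) (k : E) :
    matrixSeries (op ζ S α) (of k) (vacuum E) =
      mul (vectorCumulants ζ S k) (matrixSeries (op ζ S α) (vacuum E) (vacuum E)) := by
  funext u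
  induction u generalizing k with
  | nil => rw [mul_nil, vectorCumulants_nil, matrixSeries_nil, inner_of_vacuum, zero_mul]
  | cons j u ih =>
    rw [matrixSeries_cons (op_isSymmetric hS α), op_of, matrixSeries_add_left,
      matrixSeries_smul_left, Pi.add_apply, ih, mul_apply_cons, vectorCumulants_nil,
      D_vectorCumulants, NCSeries.add_mul, NCSeries.smul_mul_assoc, NCSeries.one_mul]
    simp

theorem matrixSeries_op_vacuum (hS : ∀ i, (S i).IsSymmetric) (α : Fin d → ℝ) :
    matrixSeries (op ζ S α) (vacuum E) (vacuum E) = one + mul (fockCumulants ζ S α)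
      (matrixSeries (op ζ S α) (vacuum E) (vacuum E)) := by
  conv_lhs => rw [matrixSeries_eq_smul_one_add_cons (op_isSymmetric hS α)]
  simp only [inner_vacuum_vacuum, one_smul, fockCumulants, cons_mul, op_vacuum,
    matrixSeries_add_left, matrixSeries_smul_left, matrixSeries_op_of hS, NCSeries.add_mul,
    NCSeries.smul_mul_assoc, NCSeries.one_mul, Complex.conj_ofReal]

end BooleanFock

/-- A word in the `Y_i` splits at the letter at which the correction `⟨Ω, ·⟩ s_i` is used. -/
theorem matrixSeries_eq_of_intertwine {T : Fin d → Module.End ℂ E} {Y : Fin d → Module.End ℂ F}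
    (hT : ∀ i, (T i).IsSymmetric) (hY : ∀ i, (Y i).IsSymmetric) {Ω : E} (r : E → F)
    (s : Fin d → F) (hr : ∀ i x, Y i (r x) = r (T i x) + ⟪Ω, x⟫_ℂ • s i) {y : F} {β : ℂ}
    (hy : ∀ x, ⟪r x, y⟫_ℂ = β * ⟪x, Ω⟫_ℂ) (x : E) :
    matrixSeries Y (r x) y = β • matrixSeries T x Ω +
      mul (matrixSeries T x Ω) (cons fun j => matrixSeries Y (s j) y) := by
  funext u
  induction u generalizing x with
  | nil => simp [hy]
  | cons i u ih =>
    rw [matrixSeries_cons hY, hr, matrixSeries_add_left, matrixSeries_smul_left, Pi.add_apply, ih]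
    simp only [Pi.add_apply, Pi.smul_apply, smul_eq_mul, cons, mul_apply_cons, D_matrixSeries hT,
      matrixSeries_cons hT, matrixSeries_nil, inner_conj_symm]
    ring

end Cumulants

namespace AlgFock

variable {E : Type u} [NormedAddCommGroup E] [InnerProductSpace ℂ E]
  {ζ : Fin d → E} {H : Fin d → Module.End ℂ E}

theorem matrixSeries_op_create_eq_mul_cons (hH : ∀ i, (H i).IsSymmetric) (lam : Fin d → ℝ)
    (k : E) :
    matrixSeries (op ζ H lam) (create k (vacuum E)) (vacuum E) =
      mul (matrixSeries (op ζ H lam) (vacuum E) (vacuum E)) (cons fun j =>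
        matrixSeries (op ζ H lam) (create (H j k) (vacuum E)) (vacuum E) +
          ⟪k, ζ j⟫_ℂ • matrixSeries (op ζ H lam) (vacuum E) (vacuum E)) := by
  have h := matrixSeries_eq_of_intertwine (op_isSymmetric hH lam) (op_isSymmetric hH lam)
    (rightCreate k) _ (fun i x => op_rightCreate ζ H lam i k x) (β := 0)
    (fun x => by rw [inner_rightCreate_vacuum, zero_mul]) (vacuum E)
  simpa only [rightCreate_vacuum, zero_smul, zero_add, matrixSeries_add_left,
    matrixSeries_smul_left, inner_conj_symm] using h

theorem matrixSeries_op_create (hH : ∀ i, (H i).IsSymmetric) (lam : Fin d → ℝ) (k : E) :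
    matrixSeries (op ζ H lam) (create k (vacuum E)) (vacuum E) =
      mul (subst (matrixSeries (op ζ H lam) (vacuum E) (vacuum E)) (vectorCumulants ζ H k))
        (matrixSeries (op ζ H lam) (vacuum E) (vacuum E)) := by
  set a := matrixSeries (op ζ H lam) (vacuum E) (vacuum E) with ha
  refine eq_of_sub_eq_mul_cons (A := a) (next := fun j k => H j k)
    (G := fun k => matrixSeries (op ζ H lam) (create k (vacuum E)) (vacuum E))
    (H := fun k => mul (subst a (vectorCumulants ζ H k)) a) (fun k => ?_) k
  have hsubst : mul (subst a (vectorCumulants ζ H k)) a = mul a (cons fun j =>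
      mul (subst a (vectorCumulants ζ H (H j k))) a + ⟪k, ζ j⟫_ℂ • a) := by
    rw [subst_of_nil_eq_zero _ (vectorCumulants_nil ζ H k), NCSeries.mul_assoc, cons_mul]
    simp only [D_vectorCumulants, subst_add, subst_smul, subst_one, NCSeries.add_mul,
      NCSeries.smul_mul_assoc, NCSeries.one_mul]
  simp only [hsubst, matrixSeries_op_create_eq_mul_cons hH lam k, ← ha, ← NCSeries.mul_sub,
    ← cons_sub, add_sub_add_right_eq_sub]

theorem matrixSeries_op_vacuum (hH : ∀ i, (H i).IsSymmetric) (lam : Fin d → ℝ) :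
    matrixSeries (op ζ H lam) (vacuum E) (vacuum E) = one +
      subst (matrixSeries (op ζ H lam) (vacuum E) (vacuum E)) (fockCumulants ζ H lam) := by
  set a := matrixSeries (op ζ H lam) (vacuum E) (vacuum E) with ha
  let η : NCSeries d := cons fun i => subst a (D i (fockCumulants ζ H lam))
  have hleft : a = one + mul η a := by
    conv_lhs => rw [ha, matrixSeries_eq_smul_one_add_cons (op_isSymmetric hH lam)]
    simp only [inner_vacuum_vacuum, one_smul, η, fockCumulants, D_cons, cons_mul, op_vacuum,
      matrixSeries_add_left, matrixSeries_smul_left, matrixSeries_op_create hH, subst_add,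
      subst_smul, subst_one, NCSeries.add_mul, NCSeries.smul_mul_assoc, NCSeries.one_mul,
      Complex.conj_ofReal, ← ha]
  rw [subst_of_nil_eq_zero _ (fockCumulants_nil ζ H lam), ← mul_one_sub_eq_one_iff]
  exact mul_eq_one_symm inner_vacuum_vacuum (one_sub_mul_eq_one_iff.2 hleft)

end AlgFock

/-! ### Representations and monotone sums -/

section Tensor

variable {E E' F F' : Type*} [NormedAddCommGroup E] [InnerProductSpace ℂ E]
  [NormedAddCommGroup E'] [InnerProductSpace ℂ E']
  [NormedAddCommGroup F] [InnerProductSpace ℂ F] [NormedAddCommGroup F'] [InnerProductSpace ℂ F']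

theorem denseRange_toComplₗᵢ_comp {J : E →ₗᵢ[ℂ] F} (hJ : DenseRange J) :
    DenseRange ((UniformSpace.Completion.toComplₗᵢ (𝕜 := ℂ) (E := F)).comp J) :=
  UniformSpace.Completion.denseRange_coe.comp hJ (UniformSpace.Completion.continuous_coe F)

theorem HilbertTensor.denseRange_incl {J : E →ₗᵢ[ℂ] F} {J' : E' →ₗᵢ[ℂ] F'} (hJ : DenseRange J)
    (hJ' : DenseRange J') : DenseRange (HilbertTensor.incl J J') := by
  refine denseRange_toComplₗᵢ_comp fun y => ?_
  change y ∈ (LinearMap.range (TensorProduct.mapIsometry J J').toLinearMap).topologicalClosure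
  induction y with
  | zero => exact Submodule.zero_mem _
  | add y y' hy hy' => exact Submodule.add_mem _ hy hy'
  | tmul f f' =>
    refine map_mem_closure₂ (f := fun f f' => f ⊗ₜ[ℂ] f') (by fun_prop) (hJ f) (hJ' f') ?_
    rintro _ ⟨e, rfl⟩ _ ⟨e', rfl⟩
    exact ⟨e ⊗ₜ e', by simp⟩

theorem BooleanFock.denseRange_incl {J : E →ₗᵢ[ℂ] F} (hJ : DenseRange J) :
    DenseRange (BooleanFock.incl J) := by
  intro y
  refine map_mem_closure (f := fun f => WithLp.toLp 2 (y.fst, f))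
    ((WithLp.prod_continuous_toLp 2 ℂ F).comp (by fun_prop)) (hJ y.snd) ?_
  rintro _ ⟨e, rfl⟩
  exact ⟨WithLp.toLp 2 (y.fst, e), rfl⟩

end Tensor

section FullFock

variable {E : Type u} [NormedAddCommGroup E] [InnerProductSpace ℂ E]
  {F : Type v} [NormedAddCommGroup F] [InnerProductSpace ℂ F]

theorem AlgFock.norm_create (e : E) (x : AlgFock E) : ‖create e x‖ = ‖e‖ * ‖x‖ := by
  rw [← sq_eq_sq₀ (norm_nonneg _) (by positivity), mul_pow]
  have h := inner_create_create e e x x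
  simp only [inner_self_eq_norm_sq_to_K] at h
  exact_mod_cast h

theorem AlgFock.continuous_create (e : E) : Continuous (create e) :=
  AddMonoidHomClass.continuous_of_bound (create e) ‖e‖ fun x => (norm_create e x).le

theorem AlgFock.continuous_create_left (x : AlgFock E) : Continuous fun e : E => create e x :=
  AddMonoidHomClass.continuous_of_bound
    (AddMonoidHom.mk' (fun e : E => create e x) fun e f => create_add e f x) ‖x‖
    fun e => ((norm_create e x).trans (mul_comm _ _)).le

theorem AlgFock.denseRange_map {J : E →ₗᵢ[ℂ] F} (hJ : DenseRange J) : DenseRange (map J) := by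
  intro y
  set R := LinearMap.range (map J).toLinearMap
  change y ∈ R.topologicalClosure
  induction y using induction_create with
  | add y z hy hz => exact Submodule.add_mem _ hy hz
  | smul c y hy => exact Submodule.smul_mem _ c hy
  | vacuum => exact R.le_topologicalClosure ⟨vacuum E, map_vacuum J⟩
  | create f y hy =>
    have hrange (e : E) : create (J e) y ∈ closure (R : Set (AlgFock F)) := by
      refine map_mem_closure (continuous_create (J e)) hy ?_
      rintro _ ⟨z, rfl⟩
      exact ⟨create e z, map_create J e z⟩
    have hclosure : create f y ∈ closure (closure (R : Set (AlgFock F))) := by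
      refine map_mem_closure (f := fun e : F => create e y) (continuous_create_left y) (hJ f) ?_
      rintro _ ⟨e, rfl⟩
      exact hrange e
    rwa [closure_closure] at hclosure

theorem FullFock.denseRange_incl {J : E →ₗᵢ[ℂ] F} (hJ : DenseRange J) :
    DenseRange (FullFock.incl J) :=
  denseRange_toComplₗᵢ_comp (AlgFock.denseRange_map hJ)

end FullFock

section Represent

variable {E 𝓗 : Type*} [NormedAddCommGroup E] [InnerProductSpace ℂ E] [NormedAddCommGroup 𝓗]
  [InnerProductSpace ℂ 𝓗]

namespace IsRepresentedOn

variable {φ : Functional d} {J : E →ₗᵢ[ℂ] 𝓗} {X : Fin d → Module.End ℂ E} {v : E}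

theorem moment_eq_matrixSeries (h : IsRepresentedOn φ J X v) : moment φ = matrixSeries X v v := by
  funext u
  rw [h.moment_eq, LinearIsometry.inner_map_map, matrixSeries]

theorem of_moment_eq (hJ : DenseRange J) (hX : ∀ i, (X i).IsSymmetric) (hv : ‖v‖ = 1)
    (h : moment φ = matrixSeries X v v) : IsRepresentedOn φ J X v :=
  ⟨hJ, hX, hv, fun u => by rw [h, LinearIsometry.inner_map_map, matrixSeries]⟩

theorem map_one (h : IsRepresentedOn φ J X v) : φ 1 = 1 := by
  rw [← moment_nil, h.moment_eq_matrixSeries, matrixSeries_nil,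
    inner_self_eq_one_of_norm_eq_one h.norm_eq_one]

theorem momentGen_eq_matrixSeries (h : IsRepresentedOn φ J X v) :
    momentGen φ = matrixSeries X v v :=
  (momentGen_eq_moment h.map_one).trans h.moment_eq_matrixSeries

end IsRepresentedOn

variable {φ : Functional d} {ζ : Fin d → E} {S : Fin d → Module.End ℂ E} {α : Fin d → ℝ}

theorem isRepresentedOn_booleanFock {J : E →ₗᵢ[ℂ] 𝓗} (hJ : DenseRange J)
    (hS : ∀ i, (S i).IsSymmetric) (h1 : φ 1 = 1) (h : booleanCumulants φ = fockCumulants ζ S α) :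
    IsRepresentedOn φ (BooleanFock.incl J) (BooleanFock.op ζ S α) (BooleanFock.vacuum E) := by
  refine .of_moment_eq (BooleanFock.denseRange_incl hJ) (BooleanFock.op_isSymmetric hS α)
    BooleanFock.norm_vacuum ?_
  refine NCSeries.mul_left_cancel (f := one - fockCumulants ζ S α)
    (by simp [fockCumulants_nil]) ?_
  rw [one_sub_mul_eq_one_iff.2 (BooleanFock.matrixSeries_op_vacuum hS α), ← h,
    ← momentGen_eq_moment h1, one_sub_mul_eq_one_iff]
  exact momentGen_eq_one_add_mul φ

theorem booleanCumulants_eq_fockCumulants {J : BooleanFock E →ₗᵢ[ℂ] 𝓗}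
    (hS : ∀ i, (S i).IsSymmetric)
    (h : IsRepresentedOn φ J (BooleanFock.op ζ S α) (BooleanFock.vacuum E)) :
    booleanCumulants φ = fockCumulants ζ S α := by
  refine booleanCumulants_eq ?_
  rw [h.momentGen_eq_matrixSeries]
  exact BooleanFock.matrixSeries_op_vacuum hS α

end Represent

section FreeRepresent

variable {E : Type u} [NormedAddCommGroup E] [InnerProductSpace ℂ E]
  {𝓗 : Type*} [NormedAddCommGroup 𝓗] [InnerProductSpace ℂ 𝓗]
  {F : Type v} [NormedAddCommGroup F] [InnerProductSpace ℂ F]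
  {φ : Functional d} {ζ : Fin d → E} {H : Fin d → Module.End ℂ E} {lam : Fin d → ℝ}

theorem isRepresentedOn_fullFock {J : E →ₗᵢ[ℂ] F} (hJ : DenseRange J)
    (hH : ∀ i, (H i).IsSymmetric) (h1 : φ 1 = 1) (h : freeCumulants φ = fockCumulants ζ H lam) :
    IsRepresentedOn φ (FullFock.incl J) (AlgFock.op ζ H lam) (AlgFock.vacuum E) := by
  refine .of_moment_eq (FullFock.denseRange_incl hJ) (AlgFock.op_isSymmetric hH lam)
    AlgFock.norm_vacuum ?_
  rw [eq_momentGen_ofFreeCumulants (fockCumulants_nil ζ H lam)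
      (AlgFock.matrixSeries_op_vacuum hH lam), ← momentGen_eq_moment h1]
  exact eq_momentGen_ofFreeCumulants (fockCumulants_nil ζ H lam)
    (h ▸ momentGen_eq_subst_freeCumulants φ)

theorem freeCumulants_eq_fockCumulants {J : AlgFock E →ₗᵢ[ℂ] 𝓗} (hH : ∀ i, (H i).IsSymmetric)
    (h : IsRepresentedOn φ J (AlgFock.op ζ H lam) (AlgFock.vacuum E)) :
    freeCumulants φ = fockCumulants ζ H lam := by
  refine freeCumulants_eq (fockCumulants_nil ζ H lam) ?_
  rw [h.momentGen_eq_matrixSeries]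
  exact AlgFock.matrixSeries_op_vacuum hH lam

end FreeRepresent

section Monotone

variable {E F : Type*} [NormedAddCommGroup E] [InnerProductSpace ℂ E]
  [NormedAddCommGroup F] [InnerProductSpace ℂ F]

theorem proj_apply (v x : E) : proj v x = ⟪v, x⟫_ℂ • v := rfl

theorem proj_isSymmetric (v : E) : (proj v).IsSymmetric := by
  intro x y
  rw [proj_apply, proj_apply, inner_smul_left, inner_smul_right, inner_conj_symm, mul_comm]

theorem tensorMap_isSymmetric {S : Module.End ℂ E} {T : Module.End ℂ F} (hS : S.IsSymmetric)
    (hT : T.IsSymmetric) : (TensorProduct.map S T : Module.End ℂ (E ⊗[ℂ] F)).IsSymmetric := by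
  intro x y
  induction x with
  | zero => simp
  | add x x' hx hx' => rw [map_add, inner_add_left, inner_add_left, hx, hx']
  | tmul e f =>
    induction y with
    | zero => simp
    | add y y' hy hy' => rw [map_add, inner_add_right, inner_add_right, hy, hy']
    | tmul e' f' =>
      rw [TensorProduct.map_tmul, TensorProduct.map_tmul, TensorProduct.inner_tmul,
        TensorProduct.inner_tmul, hS e e', hT f f']

/-- The operators `S_i ⊗ I + P_v ⊗ T_i`, the sums of monotonically independent operators. Both
`tensorOp` and `convOp` are of this form. -/
def monotoneSum (v : E) (S : Fin d → Module.End ℂ E) (T : Fin d → Module.End ℂ F) (i : Fin d) :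
    Module.End ℂ (E ⊗[ℂ] F) :=
  TensorProduct.map (S i) LinearMap.id + TensorProduct.map (proj v) (T i)

variable {v : E} {S : Fin d → Module.End ℂ E} {T : Fin d → Module.End ℂ F}

theorem monotoneSum_tmul (i : Fin d) (x : E) (y : F) :
    monotoneSum v S T i (x ⊗ₜ y) = S i x ⊗ₜ y + ⟪v, x⟫_ℂ • v ⊗ₜ T i y := by
  simp [monotoneSum, proj_apply, TensorProduct.smul_tmul']

theorem monotoneSum_isSymmetric (hS : ∀ i, (S i).IsSymmetric) (hT : ∀ i, (T i).IsSymmetric)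
    (i : Fin d) : (monotoneSum v S T i).IsSymmetric :=
  (tensorMap_isSymmetric (hS i) LinearMap.IsSymmetric.id).add
    (tensorMap_isSymmetric (proj_isSymmetric v) (hT i))

theorem matrixSeries_monotoneSum_tmul (hS : ∀ i, (S i).IsSymmetric) (hT : ∀ i, (T i).IsSymmetric)
    (y w : F) :
    matrixSeries (monotoneSum v S T) (v ⊗ₜ y) (v ⊗ₜ w) =
      mul (subst (matrixSeries S v v) (matrixSeries T y w)) (matrixSeries S v v) := by
  set b := matrixSeries S v v
  have hleft (y : F) : matrixSeries (monotoneSum v S T) (v ⊗ₜ y) (v ⊗ₜ w) = ⟪y, w⟫_ℂ • b +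
      mul b (cons fun j => matrixSeries (monotoneSum v S T) (v ⊗ₜ T j y) (v ⊗ₜ w)) :=
    matrixSeries_eq_of_intertwine hS (monotoneSum_isSymmetric hS hT) (fun x => x ⊗ₜ[ℂ] y)
      (fun j => v ⊗ₜ[ℂ] T j y) (fun i x => monotoneSum_tmul i x y)
      (fun x => by rw [TensorProduct.inner_tmul, mul_comm]) v
  have hright (y : F) : mul (subst b (matrixSeries T y w)) b = ⟪y, w⟫_ℂ • b +
      mul b (cons fun j => mul (subst b (matrixSeries T (T j y) w)) b) := by
    rw [subst_eq, NCSeries.add_mul, NCSeries.smul_mul_assoc, NCSeries.one_mul, NCSeries.mul_assoc,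
      cons_mul, matrixSeries_nil]
    simp only [D_matrixSeries hT]
  refine eq_of_sub_eq_mul_cons (A := b) (next := fun j y => T j y)
    (G := fun y => matrixSeries (monotoneSum v S T) (v ⊗ₜ y) (v ⊗ₜ w))
    (H := fun y => mul (subst b (matrixSeries T y w)) b) (fun y => ?_) y
  simp only [hleft y, hright y, add_sub_add_left_eq_sub, ← NCSeries.mul_sub, ← cons_sub]

theorem vectorCumulants_monotoneSum (hS : ∀ i, (S i).IsSymmetric) (ζ : Fin d → F) (x : E)
    (y : F) :
    vectorCumulants (fun i => v ⊗ₜ[ℂ] ζ i) (monotoneSum v S T) (x ⊗ₜ[ℂ] y) =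
      mul (matrixSeries S x v)
        (cons fun j => subst (matrixSeries S v v) (D j (vectorCumulants ζ T y))) := by
  funext u
  induction u generalizing x y with
  | nil => simp
  | cons j u ih =>
    rw [vectorCumulants, monotoneSum_tmul, vectorCumulants_add, vectorCumulants_smul,
      Pi.add_apply, Pi.smul_apply, ih, ih, ← subst_of_nil_eq_zero _ (vectorCumulants_nil ζ T _),
      mul_apply_cons, matrixSeries_nil, D_matrixSeries hS, inner_conj_symm,
      TensorProduct.inner_tmul]
    simp only [cons, D_vectorCumulants, subst_add, subst_smul, subst_one, Pi.add_apply,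
      Pi.smul_apply, smul_eq_mul, one]
    split_ifs <;> ring

theorem fockCumulants_monotoneSum (hS : ∀ i, (S i).IsSymmetric) (ζ : Fin d → F)
    (lam : Fin d → ℝ) :
    fockCumulants (fun i => v ⊗ₜ[ℂ] ζ i) (monotoneSum v S T) lam =
      cons fun i => subst (matrixSeries S v v) (D i (fockCumulants ζ T lam)) := by
  simp only [fockCumulants, D_cons, vectorCumulants_monotoneSum hS, subst_add, subst_smul,
    subst_one, ← subst_of_nil_eq_zero _ (vectorCumulants_nil ζ T _)]

end Monotone

/-! ### Models of states -/

section Involution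

theorem adj_single (u : FreeMonoid (Fin d)) (c : ℂ) :
    adj (MonoidAlgebra.single u c) =
      MonoidAlgebra.single (FreeMonoid.ofList u.toList.reverse) (conj c) := by
  simp [adj]

theorem adj_zero : adj (0 : NCPoly d) = 0 := by simp [adj]

theorem adj_one : adj (1 : NCPoly d) = 1 := by
  rw [MonoidAlgebra.one_def, adj_single]; simp

theorem adj_add (P Q : NCPoly d) : adj (P + Q) = adj P + adj Q := by
  rw [adj, MonoidAlgebra.coeff_add, Finsupp.sum_add_index']
  · rfl
  · simp
  · simp

theorem adj_smul (c : ℂ) (P : NCPoly d) : adj (c • P) = conj c • adj P := by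
  induction P using MonoidAlgebra.induction_linear with
  | zero => simp [adj_zero]
  | add P Q hP hQ => rw [smul_add, adj_add, hP, hQ, adj_add, smul_add]
  | single u a => simp [adj_single]

theorem adj_mul (P Q : NCPoly d) : adj (P * Q) = adj Q * adj P := by
  induction P using MonoidAlgebra.induction_linear with
  | zero => simp [adj_zero]
  | add P P' hP hP' => rw [add_mul, adj_add, hP, hP', adj_add, mul_add]
  | single u a =>
    induction Q using MonoidAlgebra.induction_linear with
    | zero => simp [adj_zero]
    | add P P' hP hP' => rw [mul_add, adj_add, hP, hP', adj_add, add_mul]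
    | single v b =>
      simp only [adj_single, MonoidAlgebra.single_mul_single, FreeMonoid.toList_mul,
        List.reverse_append, FreeMonoid.ofList_append, map_mul, mul_comm]

theorem adj_adj (P : NCPoly d) : adj (adj P) = P := by
  induction P using MonoidAlgebra.induction_linear with
  | zero => simp [adj_zero]
  | add P Q hP hQ => rw [adj_add, adj_add, hP, hQ]
  | single u a => simp [adj_single]

theorem monomial_cons (i : Fin d) (u : List (Fin d)) :
    monomial (i :: u) = monomial [i] * monomial u := by
  simp [monomial, MonoidAlgebra.single_mul_single, FreeMonoid.ofList_cons]

theorem adj_monomial_singleton (i : Fin d) : adj (monomial [i]) = monomial [i] := by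
  simp [monomial, adj_single]

theorem single_eq_smul_monomial (u : FreeMonoid (Fin d)) (c : ℂ) :
    (MonoidAlgebra.single u c : NCPoly d) = c • monomial u.toList := by
  simp [monomial]

end Involution

section Evaluation

/-- The value `P(a_1, …, a_d)` of a polynomial at elements of an algebra. -/
def eval {R : Type*} [Semiring R] [Algebra ℂ R] (a : Fin d → R) : NCPoly d →ₐ[ℂ] R :=
  MonoidAlgebra.lift ℂ R (FreeMonoid (Fin d)) (FreeMonoid.lift a)

theorem eval_single {R : Type*} [Semiring R] [Algebra ℂ R] (a : Fin d → R)
    (u : FreeMonoid (Fin d)) (c : ℂ) :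
    eval a (MonoidAlgebra.single u c) = c • (u.toList.map a).prod := by
  simp [eval, FreeMonoid.lift_apply]

variable {E 𝓗 : Type*} [NormedAddCommGroup E] [InnerProductSpace ℂ E] [NormedAddCommGroup 𝓗]
  [InnerProductSpace ℂ 𝓗] {X : Fin d → Module.End ℂ E}

theorem inner_word_left (hX : ∀ i, (X i).IsSymmetric) (u : List (Fin d)) (x y : E) :
    ⟪word X u x, y⟫_ℂ = ⟪x, word X u.reverse y⟫_ℂ := by
  induction u generalizing y with
  | nil => rfl
  | cons i u ih =>
    rw [word_cons, Module.End.mul_apply, hX i, ih, List.reverse_cons, word, word, List.map_append,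
      List.prod_append, Module.End.mul_apply, List.map_singleton, List.prod_singleton]

theorem inner_eval_left (hX : ∀ i, (X i).IsSymmetric) (P : NCPoly d) (x y : E) :
    ⟪eval X P x, y⟫_ℂ = ⟪x, eval X (adj P) y⟫_ℂ := by
  induction P using MonoidAlgebra.induction_linear with
  | zero => simp [adj_zero]
  | add P Q hP hQ =>
    simp only [adj_add, map_add, LinearMap.add_apply, inner_add_left, inner_add_right, hP, hQ]
  | single u c =>
    simp only [adj_single, eval_single, LinearMap.smul_apply, inner_smul_left, inner_smul_right,
      FreeMonoid.toList_ofList]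
    rw [← word, inner_word_left hX, word]

namespace IsRepresentedOn

variable {φ : Functional d} {J : E →ₗᵢ[ℂ] 𝓗} {v : E}

theorem apply_eq (h : IsRepresentedOn φ J X v) (P : NCPoly d) : φ P = ⟪v, eval X P v⟫_ℂ := by
  induction P using MonoidAlgebra.induction_linear with
  | zero => simp
  | add P Q hP hQ => rw [map_add, map_add, LinearMap.add_apply, inner_add_right, hP, hQ]
  | single u c =>
    rw [eval_single, ← word, single_eq_smul_monomial, map_smul, LinearMap.smul_apply,
      inner_smul_right, smul_eq_mul, ← matrixSeries, ← h.moment_eq_matrixSeries, moment]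

theorem isState (h : IsRepresentedOn φ J X v) : IsState φ where
  map_one := h.map_one
  map_adj P := by
    rw [h.apply_eq, h.apply_eq, ← inner_eval_left h.isSymmetric, inner_conj_symm]
  nonneg P := by
    rw [h.apply_eq, map_mul, Module.End.mul_apply, ← inner_eval_left h.isSymmetric]
    exact inner_self_nonneg (𝕜 := ℂ)

end IsRepresentedOn

end Evaluation

section GNS

theorem denseRange_subtypeₗᵢ {𝓗 : Type*} [NormedAddCommGroup 𝓗] [InnerProductSpace ℂ 𝓗]
    {dom : Submodule ℂ 𝓗} (h : Dense (dom : Set 𝓗)) : DenseRange dom.subtypeₗᵢ := by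
  simpa [DenseRange] using h

/-- The `s i` descend along `q` because by symmetry they preserve its kernel, the radical of the
form. -/
theorem exists_hilbert_of_core {V : Type u} [AddCommGroup V] [Module ℂ V]
    (c : PreInnerProductSpace.Core ℂ V) {ι : Type*} (s : ι → Module.End ℂ V)
    (hs : ∀ i x y, c.inner (s i x) y = c.inner x (s i y)) :
    ∃ (𝓗 : Type u) (_ : NormedAddCommGroup 𝓗) (_ : InnerProductSpace ℂ 𝓗) (_ : CompleteSpace 𝓗)
      (dom : Submodule ℂ 𝓗) (q : V →ₗ[ℂ] dom) (S : ι → Module.End ℂ dom),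
      Dense (dom : Set 𝓗) ∧ (∀ i, (S i).IsSymmetric) ∧ (∀ i x, S i (q x) = q (s i x)) ∧
      ∀ x y, ⟪q x, q y⟫_ℂ = c.inner x y := by
  let _ : SeminormedAddCommGroup V := InnerProductSpace.Core.toSeminormedAddCommGroup (c := c)
  let _ : InnerProductSpace ℂ V := InnerProductSpace.ofCore c
  let q₀ : V →ₗ[ℂ] UniformSpace.Completion V :=
    (UniformSpace.Completion.toComplₗᵢ (𝕜 := ℂ) (E := V)).toLinearMap
  let q : V →ₗ[ℂ] LinearMap.range q₀ := q₀.rangeRestrict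
  have hq (x y : V) : ⟪q x, q y⟫_ℂ = c.inner x y := UniformSpace.Completion.inner_coe x y
  have hsurj : Function.Surjective q := q₀.surjective_rangeRestrict
  obtain ⟨g, hg⟩ := q.exists_rightInverse_of_surjective (LinearMap.range_eq_top.mpr hsurj)
  have hqg (y : LinearMap.range q₀) : q (g y) = y := LinearMap.congr_fun hg y
  have hS (i : ι) (x : V) : (q ∘ₗ s i ∘ₗ g) (q x) = q (s i x) := by
    rw [← sub_eq_zero, ← inner_self_eq_zero (𝕜 := ℂ), LinearMap.comp_apply, LinearMap.comp_apply,
      ← map_sub, ← map_sub, hq, hs, ← hq, map_sub q (g (q x)) x, hqg, sub_self, inner_zero_left]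
  refine ⟨UniformSpace.Completion V, inferInstance, inferInstance, inferInstance,
    LinearMap.range q₀, q, fun i => q ∘ₗ s i ∘ₗ g,
    UniformSpace.Completion.denseRange_coe (α := V), fun i x y => ?_, hS, hq⟩
  obtain ⟨x, rfl⟩ := hsurj x
  obtain ⟨y, rfl⟩ := hsurj y
  rw [hS, hS, hq, hq, hs]

/-- The form `⟨x, y⟩ = L[(ι x)^* (ι y)]` on a space `V` mapping to the polynomials. The cases needed
are `ι = id` for states, and the projection onto polynomials without constant term for functionals
which are only positive on those. -/
abbrev formCore {V : Type*} [AddCommGroup V] [Module ℂ V] (L : Functional d) (ι : V →ₗ[ℂ] NCPoly d)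
    (hL : ∀ P, L (adj P) = conj (L P)) (hpos : ∀ x, 0 ≤ (L (adj (ι x) * ι x)).re) :
    PreInnerProductSpace.Core ℂ V where
  inner x y := L (adj (ι x) * ι y)
  conj_inner_symm x y := by rw [← hL, adj_mul, adj_adj]
  re_inner_nonneg := hpos
  add_left x y z := by rw [map_add, adj_add, add_mul, map_add]
  smul_left x y c := by rw [map_smul, adj_smul, smul_mul_assoc, map_smul, smul_eq_mul]

theorem exists_gns {V : Type u} [AddCommGroup V] [Module ℂ V] {L : Functional d}
    {ι : V →ₗ[ℂ] NCPoly d} {s : Fin d → Module.End ℂ V}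
    (hL : ∀ P, L (adj P) = conj (L P)) (hpos : ∀ x, 0 ≤ (L (adj (ι x) * ι x)).re)
    (hs : ∀ i x, ι (s i x) = monomial [i] * ι x) :
    ∃ (𝓗 : Type u) (_ : NormedAddCommGroup 𝓗) (_ : InnerProductSpace ℂ 𝓗) (_ : CompleteSpace 𝓗)
      (dom : Submodule ℂ 𝓗) (q : V →ₗ[ℂ] dom) (S : Fin d → Module.End ℂ dom),
      Dense (dom : Set 𝓗) ∧ (∀ i, (S i).IsSymmetric) ∧ (∀ i x, S i (q x) = q (s i x)) ∧
      ∀ x y, ⟪q x, q y⟫_ℂ = L (adj (ι x) * ι y) :=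
  exists_hilbert_of_core (formCore L ι hL hpos) s fun i x y =>
    congrArg L (by rw [hs, hs, adj_mul, adj_monomial_singleton, mul_assoc])

theorem exists_vectorData {ψ : Functional d} (hψ : IsState ψ) :
    ∃ (𝒦 : Type) (_ : NormedAddCommGroup 𝒦) (_ : InnerProductSpace ℂ 𝒦)
      (_ : CompleteSpace 𝒦) (A : VectorData d 𝒦), A.Represents ψ := by
  obtain ⟨𝒦, _, _, _, dom, q, S, hdense, hsymm, hS, hq⟩ := exists_gns (ι := LinearMap.id)
    (s := fun i => LinearMap.mulLeft ℂ (monomial [i])) hψ.map_adj hψ.nonneg fun _ _ => rfl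
  have hinner (P : NCPoly d) : ⟪q 1, q P⟫_ℂ = ψ P := by
    rw [hq, LinearMap.id_apply, LinearMap.id_apply, adj_one, one_mul]
  have hnorm : ‖q 1‖ = 1 := by
    rw [norm_eq_sqrt_re_inner (𝕜 := ℂ), hinner, hψ.map_one, RCLike.one_re, Real.sqrt_one]
  have hword (u : List (Fin d)) : word S u (q 1) = q (monomial u) := by
    induction u with
    | nil => rfl
    | cons i u ih =>
      rw [word_cons, Module.End.mul_apply, ih, hS, LinearMap.mulLeft_apply, ← monomial_cons]
  refine ⟨𝒦, inferInstance, inferInstance, inferInstance, ⟨dom, hdense, q 1, hnorm, S, hsymm⟩,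
    .of_moment_eq (denseRange_subtypeₗᵢ hdense) hsymm hnorm (funext fun u => ?_)⟩
  rw [matrixSeries, hword, hinner, moment]

end GNS

section BooleanCompression

variable {E : Type*} [NormedAddCommGroup E] [InnerProductSpace ℂ E] {v : E}

/-- The projection onto the orthogonal complement of a unit vector `v`. -/
def complProj (v : E) : Module.End ℂ E := 1 - proj v

theorem complProj_apply (v x : E) : complProj v x = x - ⟪v, x⟫_ℂ • v := rfl

theorem complProj_isSymmetric (v : E) : (complProj v).IsSymmetric :=
  LinearMap.IsSymmetric.one.sub (proj_isSymmetric v)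

theorem complProj_self (hv : ‖v‖ = 1) : complProj v v = 0 := by
  rw [complProj_apply, inner_self_eq_one_of_norm_eq_one hv, one_smul, sub_self]

theorem complProj_complProj (hv : ‖v‖ = 1) (x : E) :
    complProj v (complProj v x) = complProj v x := by
  rw [complProj_apply v x, map_sub, map_smul, complProj_self hv, smul_zero, sub_zero,
    complProj_apply]

/-- The operators on the Boolean Fock space given by the blocks of the `X_i` along `ℂv ⊕ v^⊥`, with
`v` in the role of the vacuum. The one-particle space is not cut down to `v^⊥`: the operators
vanish at `v` instead, which keeps the domains of the `X_i`. -/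
def compressionOp (v : E) (X : Fin d → Module.End ℂ E) : Fin d → Module.End ℂ (BooleanFock E) :=
  BooleanFock.op (fun i => complProj v (X i v)) (fun i => complProj v * X i * complProj v)
    fun i => (⟪v, X i v⟫_ℂ).re

/-- The decomposition of a vector along `ℂv ⊕ v^⊥`, with values in the Boolean Fock space. -/
def vacuumSplit (v x : E) : BooleanFock E := WithLp.toLp 2 (⟪v, x⟫_ℂ, complProj v x)

theorem vacuumSplit_self (hv : ‖v‖ = 1) : vacuumSplit v v = BooleanFock.vacuum E := by
  rw [vacuumSplit, inner_self_eq_one_of_norm_eq_one hv, complProj_self hv, BooleanFock.vacuum]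

theorem compressionOp_vacuumSplit (hv : ‖v‖ = 1) {X : Fin d → Module.End ℂ E}
    (hX : ∀ i, (X i).IsSymmetric) (i : Fin d) (x : E) :
    compressionOp v X i (vacuumSplit v x) = vacuumSplit v (X i x) := by
  have hx : X i x = X i (complProj v x) + ⟪v, x⟫_ℂ • X i v := by
    rw [← map_smul, ← map_add, complProj_apply, sub_add_cancel]
  have hreal : ((⟪v, X i v⟫_ℂ).re : ℂ) = ⟪v, X i v⟫_ℂ :=
    (hX i).coe_re_inner_self_apply v
  have hvacuum : ⟪complProj v (X i v), complProj v x⟫_ℂ +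
      ((⟪v, X i v⟫_ℂ).re : ℂ) * ⟪v, x⟫_ℂ = ⟪v, X i x⟫_ℂ := by
    rw [complProj_isSymmetric v, complProj_complProj hv, hX i, hreal, hx, inner_add_right,
      inner_smul_right, mul_comm]
  have hcompl : ⟪v, x⟫_ℂ • complProj v (X i v) + complProj v (X i (complProj v (complProj v x))) =
      complProj v (X i x) := by
    rw [complProj_complProj hv, hx, map_add, map_smul, add_comm]
  rw [compressionOp, BooleanFock.op_apply]
  exact congrArg (WithLp.toLp 2) (Prod.ext hvacuum hcompl)

theorem matrixSeries_compressionOp (hv : ‖v‖ = 1) {X : Fin d → Module.End ℂ E}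
    (hX : ∀ i, (X i).IsSymmetric) :
    matrixSeries (compressionOp v X) (BooleanFock.vacuum E) (BooleanFock.vacuum E) =
      matrixSeries X v v := by
  have hword (u : List (Fin d)) :
      word (compressionOp v X) u (BooleanFock.vacuum E) = vacuumSplit v (word X u v) := by
    induction u with
    | nil => exact (vacuumSplit_self hv).symm
    | cons i u ih =>
      rw [word_cons, word_cons, Module.End.mul_apply, Module.End.mul_apply, ih,
        compressionOp_vacuumSplit hv hX]
  funext u
  rw [matrixSeries, matrixSeries, hword]
  simp [BooleanFock.vacuum, vacuumSplit]

theorem exists_booleanData {φ : Functional d} (hφ : IsState φ) :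
    ∃ (𝒦 : Type) (_ : NormedAddCommGroup 𝒦) (_ : InnerProductSpace ℂ 𝒦)
      (_ : CompleteSpace 𝒦) (C : FockData d 𝒦), C.BooleanRepresents φ := by
  obtain ⟨𝒦, _, _, _, A, hA⟩ := exists_vectorData hφ
  have hsymm (i : Fin d) : (complProj A.ξ * A.K i * complProj A.ξ).IsSymmetric := fun x y => by
    simp only [Module.End.mul_apply, complProj_isSymmetric A.ξ _ _, A.symm i _ _]
  exact ⟨𝒦, inferInstance, inferInstance, inferInstance, ⟨A.dom, A.dense, _, _, hsymm, _⟩,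
    .of_moment_eq (BooleanFock.denseRange_incl (denseRange_subtypeₗᵢ A.dense))
      (BooleanFock.op_isSymmetric hsymm _) BooleanFock.norm_vacuum
      (hA.moment_eq_matrixSeries.trans (matrixSeries_compressionOp A.norm_ξ A.symm).symm)⟩

end BooleanCompression

/-! ### Freely infinitely divisible states -/

section FreePower

theorem NCSeries.tendsto_subst {ι : Type*} {l : Filter ι} {A : ι → NCSeries d} {A₀ : NCSeries d}
    (f : NCSeries d) (u : List (Fin d))
    (h : ∀ v : List (Fin d), v.length < u.length → Tendsto (fun t => A t v) l (𝓝 (A₀ v))) :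
    Tendsto (fun t => subst (A t) f u) l (𝓝 (subst A₀ f u)) := by
  simp only [subst_eq _ f, Pi.add_apply, mul_cons_apply]
  refine tendsto_const_nhds.add (tendsto_finsetSum _ fun k _ => ?_)
  have hk := k.isLt
  refine (h _ (by simp)).mul (tendsto_subst _ _ fun v hv => h v ?_)
  simp only [List.length_drop] at hv
  omega
termination_by u.length
decreasing_by
  have := k.isLt
  simp only [List.length_drop]
  omega

theorem freeCumulants_freePow (ρ : Functional d) (t : ℝ) :
    freeCumulants (freePow ρ t) = (t : ℂ) • freeCumulants ρ :=
  freeCumulants_ofFreeCumulants (by simp [freeCumulants_nil])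

theorem freePow_one (ρ : Functional d) (t : ℝ) : freePow ρ t 1 = 1 :=
  ofFreeCumulants_one _

theorem momentGen_freePow (ρ : Functional d) (t : ℝ) :
    momentGen (freePow ρ t) =
      one + (t : ℂ) • subst (momentGen (freePow ρ t)) (freeCumulants ρ) := by
  rw [← subst_smul, ← freeCumulants_freePow]
  exact momentGen_eq_subst_freeCumulants _

theorem tendsto_momentGen_freePow (ρ : Functional d) (u : List (Fin d)) :
    Tendsto (fun t : ℝ => momentGen (freePow ρ t) u) (𝓝[>] 0) (𝓝 (one u)) := by
  have hsubst : Tendsto (fun t : ℝ => subst (momentGen (freePow ρ t)) (freeCumulants ρ) u)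
      (𝓝[>] 0) (𝓝 (subst one (freeCumulants ρ) u)) :=
    tendsto_subst _ _ fun v _ => tendsto_momentGen_freePow ρ v
  have hofReal : Tendsto (fun t : ℝ => (t : ℂ)) (𝓝[>] 0) (𝓝 0) :=
    (Complex.continuous_ofReal.tendsto' 0 0 Complex.ofReal_zero).mono_left nhdsWithin_le_nhds
  have hlim := (tendsto_const_nhds (x := (one u : ℂ))).add (hofReal.mul hsubst)
  rw [zero_mul, add_zero] at hlim
  exact hlim.congr fun t => (congrFun (momentGen_freePow ρ t) u).symm
termination_by u.length

/-- The constant term of a polynomial, which is also the convolution power `ρ^{⊞ 0}`. -/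
def constantTerm : NCPoly d →ₐ[ℂ] ℂ := eval 0

theorem constantTerm_monomial (u : List (Fin d)) : constantTerm (monomial u) = one u := by
  cases u <;> simp [constantTerm, monomial, eval_single, one]

theorem constantTerm_adj (P : NCPoly d) : constantTerm (adj P) = conj (constantTerm P) := by
  induction P using MonoidAlgebra.induction_linear with
  | zero => simp [adj_zero]
  | add P Q hP hQ => rw [adj_add, map_add, hP, hQ, map_add, map_add]
  | single u c =>
    rw [adj_single, single_eq_smul_monomial, single_eq_smul_monomial, map_smul, map_smul,
      constantTerm_monomial, constantTerm_monomial]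
    by_cases hu : u.toList = [] <;> simp [one, hu]

/-- The functional with `x_u ↦ R^ρ_u`, the derivative of `t ↦ ρ^{⊞ t}` at `0`. -/
def cumulantFunctional (ρ : Functional d) : Functional d := ofMoments (freeCumulants ρ)

theorem moment_cumulantFunctional (ρ : Functional d) :
    moment (cumulantFunctional ρ) = freeCumulants ρ :=
  funext fun u => moment_ofMoments _ u

/-- The difference quotient `t⁻¹ (ρ^{⊞ t} - ρ^{⊞ 0})`, by a formula which needs no division. -/
def cumulantQuotient (ρ : Functional d) (t : ℝ) : Functional d :=
  ofMoments (subst (momentGen (freePow ρ t)) (freeCumulants ρ))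

theorem moment_cumulantQuotient (ρ : Functional d) (t : ℝ) :
    moment (cumulantQuotient ρ t) = subst (momentGen (freePow ρ t)) (freeCumulants ρ) :=
  funext fun u => moment_ofMoments _ u

theorem freePow_eq (ρ : Functional d) (t : ℝ) :
    freePow ρ t = constantTerm.toLinearMap + (t : ℂ) • cumulantQuotient ρ t := by
  refine moment_injective ?_
  rw [← momentGen_eq_moment (freePow_one ρ t), momentGen_freePow, ← moment_cumulantQuotient]
  funext u
  simp [moment, constantTerm_monomial]

theorem tendsto_cumulantQuotient (ρ : Functional d) (P : NCPoly d) :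
    Tendsto (fun t : ℝ => cumulantQuotient ρ t P) (𝓝[>] 0) (𝓝 (cumulantFunctional ρ P)) := by
  induction P using MonoidAlgebra.induction_linear with
  | zero => simp
  | add P Q hP hQ => simpa only [map_add] using hP.add hQ
  | single u c =>
    simp only [single_eq_smul_monomial, map_smul]
    refine Tendsto.const_smul ?_ c
    change Tendsto (fun t => moment (cumulantQuotient ρ t) u.toList) _
      (𝓝 (moment (cumulantFunctional ρ) u.toList))
    simp only [moment_cumulantQuotient, moment_cumulantFunctional]
    simpa only [subst_one_left] using tendsto_subst (A₀ := one) (freeCumulants ρ) u.toList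
      fun v _ => tendsto_momentGen_freePow ρ v

theorem cumulantFunctional_adj {ρ : Functional d} (hρ : IsFreelyInfDivState ρ) (P : NCPoly d) :
    cumulantFunctional ρ (adj P) = conj (cumulantFunctional ρ P) := by
  refine tendsto_nhds_unique (tendsto_cumulantQuotient ρ (adj P)) ?_
  refine ((Complex.continuous_conj.tendsto _).comp (tendsto_cumulantQuotient ρ P)).congr' ?_
  filter_upwards [self_mem_nhdsWithin] with t ht
  have hadj := (hρ.isState_freePow t (le_of_lt ht)).map_adj P
  simp only [freePow_eq, LinearMap.add_apply, LinearMap.smul_apply, AlgHom.toLinearMap_apply,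
    constantTerm_adj, map_add, add_right_inj, smul_eq_mul, map_mul, Complex.conj_ofReal] at hadj
  exact (mul_left_cancel₀ (Complex.ofReal_ne_zero.2 (ne_of_gt ht)) hadj).symm

theorem cumulantFunctional_nonneg {ρ : Functional d} (hρ : IsFreelyInfDivState ρ) {P : NCPoly d}
    (hP : constantTerm P = 0) : 0 ≤ (cumulantFunctional ρ (adj P * P)).re := by
  refine ge_of_tendsto ((Complex.continuous_re.tendsto _).comp
    (tendsto_cumulantQuotient ρ (adj P * P))) ?_
  filter_upwards [self_mem_nhdsWithin] with t ht
  have hpos := (hρ.isState_freePow t (le_of_lt ht)).nonneg P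
  rw [freePow_eq, LinearMap.add_apply, AlgHom.toLinearMap_apply, map_mul, hP, mul_zero, zero_add,
    LinearMap.smul_apply, smul_eq_mul, Complex.re_ofReal_mul] at hpos
  exact nonneg_of_mul_nonneg_right hpos ht

end FreePower

section FreeModel

/-- The projection `P ↦ P - P(0)` onto the polynomials without constant term. -/
def centering : Module.End ℂ (NCPoly d) :=
  LinearMap.id - Algebra.linearMap ℂ (NCPoly d) ∘ₗ constantTerm.toLinearMap

theorem centering_apply (P : NCPoly d) :
    centering P = P - algebraMap ℂ (NCPoly d) (constantTerm P) := rfl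

theorem constantTerm_centering (P : NCPoly d) : constantTerm (centering P) = 0 := by
  rw [centering_apply, map_sub, AlgHom.commutes, Algebra.algebraMap_self_apply, sub_self]

theorem centering_eq_self {P : NCPoly d} (hP : constantTerm P = 0) : centering P = P := by
  rw [centering_apply, hP, map_zero, sub_zero]

theorem centering_monomial_singleton (i : Fin d) :
    centering (monomial [i]) = (monomial [i] : NCPoly d) :=
  centering_eq_self (constantTerm_monomial [i])

theorem centering_monomial_singleton_mul (i : Fin d) (P : NCPoly d) :
    centering (monomial [i] * P) = monomial [i] * P :=
  centering_eq_self (by rw [map_mul, constantTerm_monomial, one_cons, zero_mul])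

variable {E : Type*} [NormedAddCommGroup E] [InnerProductSpace ℂ E] {L : Functional d}
  {q : NCPoly d →ₗ[ℂ] E} {S : Fin d → Module.End ℂ E}

theorem vectorCumulants_gns (hS : ∀ i P, S i (q P) = q (monomial [i] * centering P))
    (hq : ∀ P Q, ⟪q P, q Q⟫_ℂ = L (adj (centering P) * centering Q)) (P : NCPoly d)
    (u : List (Fin d)) :
    vectorCumulants (fun i => q (monomial [i])) S (q P) u =
      if u = [] then 0 else L (adj (centering P) * monomial u) := by
  induction u generalizing P with
  | nil => rw [vectorCumulants_nil, if_pos rfl]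
  | cons j u ih =>
    rw [vectorCumulants, hS, ih, hq, centering_monomial_singleton_mul, adj_mul,
      adj_monomial_singleton, mul_assoc, ← monomial_cons, centering_monomial_singleton]
    by_cases hu : u = [] <;> simp [hu]

theorem fockCumulants_gns (hL : ∀ P, L (adj P) = conj (L P)) (hL1 : L 1 = 0)
    (hS : ∀ i P, S i (q P) = q (monomial [i] * centering P))
    (hq : ∀ P Q, ⟪q P, q Q⟫_ℂ = L (adj (centering P) * centering Q)) :
    fockCumulants (fun i => q (monomial [i])) S (fun i => (L (monomial [i])).re) = moment L := by
  have hreal (i : Fin d) : ((L (monomial [i])).re : ℂ) = L (monomial [i]) := by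
    rw [← Complex.conj_eq_iff_re, ← hL, adj_monomial_singleton]
  funext u
  cases u with
  | nil => rw [fockCumulants_nil, moment_nil, hL1]
  | cons i u =>
    rw [fockCumulants, cons, Pi.add_apply, Pi.smul_apply, vectorCumulants_gns hS hq, hreal,
      centering_monomial_singleton, adj_monomial_singleton, ← monomial_cons, moment]
    by_cases hu : u = [] <;> simp [hu, one]

theorem exists_freeData {ρ : Functional d} (hρ : IsFreelyInfDivState ρ) :
    ∃ (ℋ : Type) (_ : NormedAddCommGroup ℋ) (_ : InnerProductSpace ℂ ℋ)
      (_ : CompleteSpace ℋ) (B : FockData d ℋ), B.FreeRepresents ρ := by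
  have hL1 : cumulantFunctional ρ 1 = 0 := by
    rw [← moment_nil, moment_cumulantFunctional, freeCumulants_nil]
  obtain ⟨ℋ, _, _, _, dom, q, S, hdense, hsymm, hS, hq⟩ := exists_gns
    (ι := centering) (s := fun i => LinearMap.mulLeft ℂ (monomial [i]) ∘ₗ centering)
    (cumulantFunctional_adj hρ) (fun P => cumulantFunctional_nonneg hρ (constantTerm_centering P))
    fun i P => centering_monomial_singleton_mul i (centering P)
  refine ⟨ℋ, inferInstance, inferInstance, inferInstance,
    ⟨dom, hdense, fun i => q (monomial [i]), S, hsymm,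
    fun i => (cumulantFunctional ρ (monomial [i])).re⟩,
    isRepresentedOn_fullFock (denseRange_subtypeₗᵢ hdense) hsymm hρ.isState.map_one ?_⟩
  rw [← moment_cumulantFunctional]
  exact (fockCumulants_gns (cumulantFunctional_adj hρ) hL1 hS hq).symm

theorem isFreelyInfDivState_of_freeCumulants {E : Type u} [NormedAddCommGroup E]
    [InnerProductSpace ℂ E] {ζ : Fin d → E} {H : Fin d → Module.End ℂ E} {lam : Fin d → ℝ}
    (hH : ∀ i, (H i).IsSymmetric) {ρ : Functional d} (h1 : ρ 1 = 1)
    (h : freeCumulants ρ = fockCumulants ζ H lam) : IsFreelyInfDivState ρ := by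
  have hid : DenseRange (LinearIsometry.id (R := ℂ) (E := E)) :=
    Function.surjective_id.denseRange
  refine ⟨(isRepresentedOn_fullFock hid hH h1 h).isState, fun t ht => ?_⟩
  have ht' : freeCumulants (freePow ρ t) =
      fockCumulants (fun i => (√t : ℂ) • ζ i) H (fun i => t * lam i) := by
    rw [freeCumulants_freePow, h, fockCumulants_sqrt_smul _ _ _ ht]
  exact (isRepresentedOn_fullFock hid hH (freePow_one ρ t) ht').isState

end FreeModel

section TensorModels

variable {𝒦 : Type u} [NormedAddCommGroup 𝒦] [InnerProductSpace ℂ 𝒦]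
  {ℋ : Type v} [NormedAddCommGroup ℋ] [InnerProductSpace ℂ ℋ]
  {A : VectorData d 𝒦} {B : FockData d ℋ} {ρ ψ φ : Functional d}

theorem denseRange_tensorIncl (A : VectorData d 𝒦) (B : FockData d ℋ) :
    DenseRange (tensorIncl A B) :=
  HilbertTensor.denseRange_incl (denseRange_subtypeₗᵢ A.dense) (denseRange_subtypeₗᵢ B.dense)

theorem tensorOp_isSymmetric (A : VectorData d 𝒦) (B : FockData d ℋ) (i : Fin d) :
    LinearMap.IsSymmetric (𝕜 := ℂ) (E := A.dom ⊗[ℂ] B.dom) (tensorOp A B i) :=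
  monotoneSum_isSymmetric A.symm B.symm i

theorem phiCumulants_eq_fockCumulants (hA : A.Represents ψ) (hB : B.FreeRepresents ρ) :
    phiCumulants ρ ψ = fockCumulants (tensorVec A B) (tensorOp A B) B.lam := by
  rw [phiCumulants_eq_cons, hA.momentGen_eq_matrixSeries, freeCumulants_eq_fockCumulants B.symm hB]
  exact (fockCumulants_monotoneSum A.symm B.ζ B.lam).symm

theorem isRepresentedOn_Phi (hA : A.Represents ψ) (hB : B.FreeRepresents ρ) :
    IsRepresentedOn (𝓗 := BooleanFock (HilbertTensor 𝒦 ℋ)) (Phi ρ ψ)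
      (BooleanFock.incl (tensorIncl A B))
      (BooleanFock.op (tensorVec A B) (tensorOp A B) B.lam)
      (BooleanFock.vacuum (A.dom ⊗[ℂ] B.dom)) :=
  isRepresentedOn_booleanFock (denseRange_tensorIncl A B) (tensorOp_isSymmetric A B)
    (ofBooleanCumulants_one _)
    ((booleanCumulants_Phi ρ ψ).trans (phiCumulants_eq_fockCumulants hA hB))

theorem FockData.BooleanRepresents.freeCumulants_BercoviciPata (hB : B.BooleanRepresents φ) :
    freeCumulants (BercoviciPata φ) = fockCumulants B.ζ B.H B.lam :=
  (TwoState.freeCumulants_BercoviciPata φ).trans (booleanCumulants_eq_fockCumulants B.symm hB)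

theorem isRepresentedOn_BercoviciPata (hB : B.BooleanRepresents φ) :
    B.FreeRepresents (BercoviciPata φ) :=
  isRepresentedOn_fullFock (denseRange_subtypeₗᵢ B.dense) B.symm (ofFreeCumulants_one _)
    hB.freeCumulants_BercoviciPata

theorem isRepresentedOn_BercoviciPata_Phi (hA : A.Represents ψ) (hB : B.FreeRepresents ρ) :
    IsRepresentedOn (BercoviciPata (Phi ρ ψ)) (FullFock.incl (tensorIncl A B))
      (AlgFock.op (tensorVec A B) (tensorOp A B) B.lam)
      (AlgFock.vacuum (A.dom ⊗[ℂ] B.dom)) := by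
  refine isRepresentedOn_fullFock (denseRange_tensorIncl A B) (tensorOp_isSymmetric A B)
    (ofFreeCumulants_one _) ?_
  rw [freeCumulants_BercoviciPata, booleanCumulants_Phi, phiCumulants_eq_fockCumulants hA hB]

theorem convOp_eq_monotoneSum (A : VectorData d 𝒦) (B : FockData d ℋ) :
    convOp A B = monotoneSum (AlgFock.vacuum (A.dom ⊗[ℂ] B.dom))
      (AlgFock.op (tensorVec A B) (tensorOp A B) B.lam) A.K := by
  funext i
  have hone : TensorProduct.map (1 : Module.End ℂ (AlgFock (A.dom ⊗[ℂ] B.dom)))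
      (LinearMap.id : A.dom →ₗ[ℂ] A.dom) = 1 := TensorProduct.map_id
  rw [convOp, leftK, monotoneSum, AlgFock.op, tensorOp, AlgFock.gauge_add,
    TensorProduct.map_add_left, TensorProduct.map_add_left, TensorProduct.map_add_left,
    TensorProduct.map_add_left, TensorProduct.map_smul_left, hone]
  abel

theorem isRepresentedOn_freeConv (hA : A.Represents ψ) (hB : B.FreeRepresents ρ) :
    IsRepresentedOn (freeConv ψ ρ) (convIncl A B) (convOp A B)
      (AlgFock.vacuum (A.dom ⊗[ℂ] B.dom) ⊗ₜ[ℂ] A.ξ) := by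
  have hone : freeConv ψ ρ 1 = 1 := ofFreeCumulants_one _
  have hop := AlgFock.op_isSymmetric (ζ := tensorVec A B) (tensorOp_isSymmetric A B) B.lam
  rw [convOp_eq_monotoneSum]
  refine .of_moment_eq (HilbertTensor.denseRange_incl
    (FullFock.denseRange_incl (denseRange_tensorIncl A B)) (denseRange_subtypeₗᵢ A.dense))
    (monotoneSum_isSymmetric hop A.symm) ?_ ?_
  · rw [TensorProduct.norm_tmul, AlgFock.norm_vacuum, A.norm_ξ, mul_one]
  · rw [← momentGen_eq_moment hone, momentGen_freeConv,
      (isRepresentedOn_BercoviciPata_Phi hA hB).momentGen_eq_matrixSeries,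
      hA.momentGen_eq_matrixSeries, matrixSeries_monotoneSum_tmul hop A.symm]

theorem isState_Phi (hρ : IsFreelyInfDivState ρ) (hψ : IsState ψ) : IsState (Phi ρ ψ) := by
  obtain ⟨𝒦, _, _, _, A, hA⟩ := exists_vectorData hψ
  obtain ⟨ℋ, _, _, _, B, hB⟩ := exists_freeData hρ
  exact (isRepresentedOn_Phi hA hB).isState

theorem isState_freeConv (hρ : IsFreelyInfDivState ρ) (hψ : IsState ψ) :
    IsState (freeConv ψ ρ) := by
  obtain ⟨𝒦, _, _, _, A, hA⟩ := exists_vectorData hψ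
  obtain ⟨ℋ, _, _, _, B, hB⟩ := exists_freeData hρ
  exact (isRepresentedOn_freeConv hA hB).isState

theorem isFreelyInfDivState_BercoviciPata (hφ : IsState φ) :
    IsFreelyInfDivState (BercoviciPata φ) := by
  obtain ⟨𝒦, _, _, _, C, hC⟩ := exists_booleanData hφ
  exact isFreelyInfDivState_of_freeCumulants C.symm (ofFreeCumulants_one _)
    hC.freeCumulants_BercoviciPata

end TensorModels

end TwoState

end

open TwoState in
theorem mainTheorem9_general (d : ℕ) :
    ((∀ ψ : Functional d, IsState ψ →
        ∃ (𝒦 : Type) (_ : NormedAddCommGroup 𝒦) (_ : InnerProductSpace ℂ 𝒦)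
          (_ : CompleteSpace 𝒦) (A : VectorData d 𝒦), A.Represents ψ) ∧
      (∀ φ : Functional d, IsState φ →
        ∃ (𝒦 : Type) (_ : NormedAddCommGroup 𝒦) (_ : InnerProductSpace ℂ 𝒦)
          (_ : CompleteSpace 𝒦) (C : FockData d 𝒦), C.BooleanRepresents φ) ∧
      (∀ ρ : Functional d, IsFreelyInfDivState ρ →
        ∃ (ℋ : Type) (_ : NormedAddCommGroup ℋ) (_ : InnerProductSpace ℂ ℋ)
          (_ : CompleteSpace ℋ) (B : FockData d ℋ), B.FreeRepresents ρ)) ∧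
    (∀ ρ ψ : Functional d,
      (IsFreelyInfDivState ρ → IsState ψ → IsState (Phi ρ ψ)) ∧
      ∀ (𝒦 : Type u) [NormedAddCommGroup 𝒦] [InnerProductSpace ℂ 𝒦]
        (ℋ : Type v) [NormedAddCommGroup ℋ] [InnerProductSpace ℂ ℋ]
        (A : VectorData d 𝒦) (B : FockData d ℋ), A.Represents ψ → B.FreeRepresents ρ →
        IsRepresentedOn (𝓗 := BooleanFock (HilbertTensor 𝒦 ℋ)) (Phi ρ ψ)
          (BooleanFock.incl (tensorIncl A B))
          (BooleanFock.op (tensorVec A B) (tensorOp A B) B.lam)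
          (BooleanFock.vacuum (A.dom ⊗[ℂ] B.dom))) ∧
    (∀ φ : Functional d,
      (IsState φ → IsFreelyInfDivState (BercoviciPata φ)) ∧
      ∀ (𝒦 : Type u) [NormedAddCommGroup 𝒦] [InnerProductSpace ℂ 𝒦]
        (C : FockData d 𝒦), C.BooleanRepresents φ → C.FreeRepresents (BercoviciPata φ)) ∧
    (∀ ρ ψ : Functional d,
      (IsFreelyInfDivState ρ → IsState ψ → IsState (freeConv ψ ρ)) ∧
      ∀ (𝒦 : Type u) [NormedAddCommGroup 𝒦] [InnerProductSpace ℂ 𝒦]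
        (ℋ : Type v) [NormedAddCommGroup ℋ] [InnerProductSpace ℂ ℋ]
        (A : VectorData d 𝒦) (B : FockData d ℋ), A.Represents ψ → B.FreeRepresents ρ →
        IsRepresentedOn (freeConv ψ ρ) (convIncl A B) (convOp A B)
          (AlgFock.vacuum (A.dom ⊗[ℂ] B.dom) ⊗ₜ[ℂ] A.ξ)) ∧
    (∀ ρ ψ : Functional d,
      BercoviciPata (Phi ρ ψ) = Phi ρ (freeConv ψ ρ) ∧
      ∀ (𝒦 : Type u) [NormedAddCommGroup 𝒦] [InnerProductSpace ℂ 𝒦]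
        (ℋ : Type v) [NormedAddCommGroup ℋ] [InnerProductSpace ℂ ℋ]
        (A : VectorData d 𝒦) (B : FockData d ℋ), A.Represents ψ → B.FreeRepresents ρ →
        IsRepresentedOn (BercoviciPata (Phi ρ ψ)) (FullFock.incl (tensorIncl A B))
          (AlgFock.op (tensorVec A B) (tensorOp A B) B.lam)
          (AlgFock.vacuum (A.dom ⊗[ℂ] B.dom)) ∧
        IsRepresentedOn (Phi ρ (freeConv ψ ρ)) (FullFock.incl (tensorIncl A B))
          (AlgFock.op (tensorVec A B) (tensorOp A B) B.lam)
          (AlgFock.vacuum (A.dom ⊗[ℂ] B.dom))) := by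
  refine ⟨⟨fun _ => exists_vectorData, fun _ => exists_booleanData, fun _ => exists_freeData⟩,
    fun ρ ψ => ⟨isState_Phi, ?_⟩, fun φ => ⟨isFreelyInfDivState_BercoviciPata, ?_⟩,
    fun ρ ψ => ⟨isState_freeConv, ?_⟩, fun ρ ψ => ⟨BercoviciPata_Phi ρ ψ, ?_⟩⟩
  · intro 𝒦 _ _ ℋ _ _ A B hA hB
    exact isRepresentedOn_Phi hA hB
  · intro 𝒦 _ _ C hC
    exact isRepresentedOn_BercoviciPata hC
  · intro 𝒦 _ _ ℋ _ _ A B hA hB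
    exact isRepresentedOn_freeConv hA hB
  · intro 𝒦 _ _ ℋ _ _ A B hA hB
    rw [← BercoviciPata_Phi ρ ψ]
    exact ⟨isRepresentedOn_BercoviciPata_Phi hA hB, isRepresentedOn_BercoviciPata_Phi hA hB⟩

open TwoState in
theorem mainTheorem9 (d : ℕ) :
    -- every state and every freely infinitely divisible state arises from data
    ((∀ ψ : Functional d, IsState ψ →
        ∃ (𝒦 : Type) (_ : NormedAddCommGroup 𝒦) (_ : InnerProductSpace ℂ 𝒦)
          (_ : CompleteSpace 𝒦) (A : VectorData d 𝒦), A.Represents ψ) ∧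
      (∀ φ : Functional d, IsState φ →
        ∃ (𝒦 : Type) (_ : NormedAddCommGroup 𝒦) (_ : InnerProductSpace ℂ 𝒦)
          (_ : CompleteSpace 𝒦) (C : FockData d 𝒦), C.BooleanRepresents φ) ∧
      (∀ ρ : Functional d, IsFreelyInfDivState ρ →
        ∃ (ℋ : Type) (_ : NormedAddCommGroup ℋ) (_ : InnerProductSpace ℂ ℋ)
          (_ : CompleteSpace ℋ) (B : FockData d ℋ), B.FreeRepresents ρ)) ∧
    -- (a) the model of `Φ[ρ, ψ]` on the Boolean Fock space over `𝒦 ⊗ ℋ`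
    (∀ ρ ψ : Functional d, IsFreelyInfDivState ρ → IsState ψ →
      IsState (Phi ρ ψ) ∧
      ∀ (𝒦 : Type u) [NormedAddCommGroup 𝒦] [InnerProductSpace ℂ 𝒦] [CompleteSpace 𝒦]
        (ℋ : Type v) [NormedAddCommGroup ℋ] [InnerProductSpace ℂ ℋ] [CompleteSpace ℋ]
        (A : VectorData d 𝒦) (B : FockData d ℋ), A.Represents ψ → B.FreeRepresents ρ →
        IsRepresentedOn (𝓗 := BooleanFock (HilbertTensor 𝒦 ℋ)) (Phi ρ ψ)
          (BooleanFock.incl (tensorIncl A B))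
          (BooleanFock.op (tensorVec A B) (tensorOp A B) B.lam)
          (BooleanFock.vacuum (A.dom ⊗[ℂ] B.dom))) ∧
    -- (b) the model of `𝔹[φ]` on the full Fock space over `𝒦`
    (∀ φ : Functional d, IsState φ →
      IsFreelyInfDivState (BercoviciPata φ) ∧
      ∀ (𝒦 : Type u) [NormedAddCommGroup 𝒦] [InnerProductSpace ℂ 𝒦] [CompleteSpace 𝒦]
        (C : FockData d 𝒦), C.BooleanRepresents φ → C.FreeRepresents (BercoviciPata φ)) ∧
    -- (c) the model of `ψ ⊞ ρ` on `𝓕(𝒦 ⊗ ℋ) ⊗ 𝒦`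
    (∀ ρ ψ : Functional d, IsFreelyInfDivState ρ → IsState ψ →
      IsState (freeConv ψ ρ) ∧
      ∀ (𝒦 : Type u) [NormedAddCommGroup 𝒦] [InnerProductSpace ℂ 𝒦] [CompleteSpace 𝒦]
        (ℋ : Type v) [NormedAddCommGroup ℋ] [InnerProductSpace ℂ ℋ] [CompleteSpace ℋ]
        (A : VectorData d 𝒦) (B : FockData d ℋ), A.Represents ψ → B.FreeRepresents ρ →
        IsRepresentedOn (freeConv ψ ρ) (convIncl A B) (convOp A B)
          (AlgFock.vacuum (A.dom ⊗[ℂ] B.dom) ⊗ₜ[ℂ] A.ξ)) ∧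
    -- (d) `𝔹[Φ[ρ, ψ]] = Φ[ρ, ψ ⊞ ρ]`, with a common model on `𝓕(𝒦 ⊗ ℋ)`
    (∀ ρ ψ : Functional d, IsFreelyInfDivState ρ → IsState ψ →
      BercoviciPata (Phi ρ ψ) = Phi ρ (freeConv ψ ρ) ∧
      ∀ (𝒦 : Type u) [NormedAddCommGroup 𝒦] [InnerProductSpace ℂ 𝒦] [CompleteSpace 𝒦]
        (ℋ : Type v) [NormedAddCommGroup ℋ] [InnerProductSpace ℂ ℋ] [CompleteSpace ℋ]
        (A : VectorData d 𝒦) (B : FockData d ℋ), A.Represents ψ → B.FreeRepresents ρ →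
        IsRepresentedOn (BercoviciPata (Phi ρ ψ)) (FullFock.incl (tensorIncl A B))
          (AlgFock.op (tensorVec A B) (tensorOp A B) B.lam)
          (AlgFock.vacuum (A.dom ⊗[ℂ] B.dom)) ∧
        IsRepresentedOn (Phi ρ (freeConv ψ ρ)) (FullFock.incl (tensorIncl A B))
          (AlgFock.op (tensorVec A B) (tensorOp A B) B.lam)
          (AlgFock.vacuum (A.dom ⊗[ℂ] B.dom))) := by
  obtain ⟨hex, ha, hb, hc, hd⟩ := mainTheorem9_general.{u, v} d
  exact ⟨hex, fun ρ ψ hρ hψ => ⟨(ha ρ ψ).1 hρ hψ, fun 𝒦 _ _ _ ℋ _ _ _ => (ha ρ ψ).2 𝒦 ℋ⟩,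
    fun φ hφ => ⟨(hb φ).1 hφ, fun 𝒦 _ _ _ => (hb φ).2 𝒦⟩,
    fun ρ ψ hρ hψ => ⟨(hc ρ ψ).1 hρ hψ, fun 𝒦 _ _ _ ℋ _ _ _ => (hc ρ ψ).2 𝒦 ℋ⟩,
    fun ρ ψ _ _ => ⟨(hd ρ ψ).1, fun 𝒦 _ _ _ ℋ _ _ _ => (hd ρ ψ).2 𝒦 ℋ⟩⟩
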